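/- Fix positive integers $u,v$ and let $\mathfrak{C}_{vu}=\mathbb{Z}^2/(-u,v)\mathbb{Z}$, with $\langle i,j\rangle$ the class of $(i,j)$ and with the partial order generated by $\langle i,j\rangle<\langle i+1,j\rangle$ and $\langle i,j\rangle<\langle i,j+1\rangle$. A \emph{cylindric skew shape} $C$ is a finite convex subposet of $\mathfrak{C}_{vu}$. A \emph{semistandard cylindric tableau} of shape $C$ is a map $T:C\to\{1,2,\ldots\}$ that weakly increases along the rows ($j$ fixed, $i$ increasing) and strictly increases along the columns ($i$ fixed, $j$ increasing), and the \emph{cylindric skew Schur function} of $C$ is $s_C(x)=\sum_T\prod_{c\in C}x_{T(c)}$, in the variables $x=(x_1,x_2,\ldots)$, summed over all such $T$. For a composition $\alpha=(\alpha_1,\ldots,\alpha_k)$ let $M_\alpha=\sum_{i_1<\cdots<i_k}x_{i_1}^{\alpha_1}\cdots x_{i_k}^{\alpha_k}$ and let $F_\alpha=\sum_\beta M_\beta$, summed over all compositions $\beta$ refining $\alpha$ (the fundamental quasisymmetric functions). A power series is \emph{$F$-positive} if it is a finite linear combination of functions $F_\alpha$ with nonnegative rational coefficients. Say that $C$ is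 \emph{isomorphic to a skew shape} if for some partitions $\mu\subseteq\lambda$ there is a poset isomorphism from $C$ to the set of boxes $(r,c)$ ($r$ the row, $c$ the column) of $\lambda/\mu$ with the componentwise order, under which the strict edges of $C$ (the pairs $\langle i,j\rangle,\langle i,j+1\rangle$ of boxes of $C$) correspond exactly to the strict edges of $\lambda/\mu$ (the pairs $(r,c),(r+1,c)$ of boxes of $\lambda/\mu$). \textbf{Theorem.} Let $C$ be a cylindric skew shape. Then $s_C(x)$ is $F$-positive if and only if $C$ is isomorphic to a skew shape. -/

import Mathlib

namespace CylindricSchur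

/-! ### Quasisymmetric functions in the variables `x_1, x_2, …` -/

/-- The formal sum of monomials `∑ a, x ^ (w a)`: the coefficient of `x ^ d` is the number of
indices `a` with `w a = d`. (In the uses below this number is always finite, see
`finite_exponent_fiber`.) -/
noncomputable def monomialSum {ι : Type*} (w : ι → (ℕ+ →₀ ℕ)) : MvPowerSeries ℕ+ ℚ :=
  fun d => (Nat.card {a : ι // w a = d} : ℚ)

/-- The exponent vector of the monomial `∏ c, x_{T c} ^ {e c}`. -/
noncomputable def exponent {κ : Type*} [Fintype κ] (e : κ → ℕ) (T : κ → ℕ+) : ℕ+ →₀ ℕ :=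
  ∑ c, Finsupp.single (T c) (e c)

/-- Only finitely many maps `T` yield a given monomial when all the exponents are positive. -/
theorem finite_exponent_fiber {κ : Type*} [Fintype κ] (e : κ → ℕ) (he : ∀ c, 0 < e c)
    (d : ℕ+ →₀ ℕ) : {T : κ → ℕ+ | exponent e T = d}.Finite := by
  classical
  refine (Set.Finite.pi' (fun _ : κ => d.support.finite_toSet)).subset ?_
  rintro T rfl c
  have h : e c ≤ exponent e T (T c) := by
    simp only [exponent, Finsupp.finsetSum_apply]
    calc e c = Finsupp.single (T c) (e c) (T c) := by simp
      _ ≤ _ := Finset.single_le_sum (f := fun b => Finsupp.single (T b) (e b) (T c))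
        (fun _ _ => Nat.zero_le _) (Finset.mem_univ c)
  have := he c
  simp only [Finset.mem_coe, Finsupp.mem_support_iff]
  omega

/-- The monomial quasisymmetric function
`M_α = ∑_{i_1 < ⋯ < i_k} x_{i_1}^{α_1} ⋯ x_{i_k}^{α_k}`. -/
noncomputable def monomialQSym {n : ℕ} (α : Composition n) : MvPowerSeries ℕ+ ℚ :=
  monomialSum fun i : {i : Fin α.length → ℕ+ // StrictMono i} => exponent α.blocksFun i.1

/-- The composition `β` refines `α`: every partial sum of `α` is a partial sum of `β`. -/
def Refines {n : ℕ} (β α : Composition n) : Prop :=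
  α.boundaries ⊆ β.boundaries

open Classical in
/-- The fundamental quasisymmetric function `F_α = ∑ M_β`, over the refinements `β` of `α`. -/
noncomputable def fundamentalQSym {n : ℕ} (α : Composition n) : MvPowerSeries ℕ+ ℚ :=
  ∑ β : Composition n with Refines β α, monomialQSym β

/-- `f` is `F`-positive: it is a (finite) linear combination of fundamental quasisymmetric
functions with nonnegative coefficients. -/
def IsFPositive (f : MvPowerSeries ℕ+ ℚ) : Prop :=
  ∃ c : (Σ n : ℕ, Composition n) →₀ ℚ,
    (∀ α, 0 ≤ c α) ∧ f = c.sum fun α a => a • fundamentalQSym α.2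

/-! ### The cylinder -/

/-- The cylinder `ℤ² / (-u, v)ℤ`, with `v` rows and `u` columns. -/
def Cylinder (v u : ℕ+) : Type :=
  (ℤ × ℤ) ⧸ AddSubgroup.zmultiples ((-((u : ℕ) : ℤ), ((v : ℕ) : ℤ)) : ℤ × ℤ)

namespace Cylinder

variable {v u : ℕ+}

/-- The class `⟨i, j⟩` of the lattice point `(i, j)`. -/
def mk (i j : ℤ) : Cylinder v u :=
  QuotientAddGroup.mk (s := AddSubgroup.zmultiples
    ((-((u : ℕ) : ℤ), ((v : ℕ) : ℤ)) : ℤ × ℤ)) (i, j)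

/-- The relations `⟨i, j⟩ < ⟨i + 1, j⟩` and `⟨i, j⟩ < ⟨i, j + 1⟩`. -/
def Step (x y : Cylinder v u) : Prop :=
  ∃ i j : ℤ, x = mk i j ∧ (y = mk (i + 1) j ∨ y = mk i (j + 1))

/-- The function `⟨i, j⟩ ↦ v i + u j`, which is well defined and increases along every step. -/
def height : Cylinder v u → ℤ :=
  QuotientAddGroup.lift (AddSubgroup.zmultiples ((-((u : ℕ) : ℤ), ((v : ℕ) : ℤ)) : ℤ × ℤ))
    ((AddMonoidHom.mulLeft ((v : ℕ) : ℤ)).comp (AddMonoidHom.fst ℤ ℤ) +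
      (AddMonoidHom.mulLeft ((u : ℕ) : ℤ)).comp (AddMonoidHom.snd ℤ ℤ)) (by
    rw [AddSubgroup.zmultiples_le]
    simp [AddMonoidHom.mem_ker]
    ring)

theorem height_mk (i j : ℤ) :
    height (mk i j : Cylinder v u) = (v : ℕ) * i + (u : ℕ) * j := rfl

theorem height_lt_of_step {x y : Cylinder v u} (h : Step x y) : height x < height y := by
  have hu : (0 : ℤ) < (u : ℕ) := by exact_mod_cast u.pos
  have hv : (0 : ℤ) < (v : ℕ) := by exact_mod_cast v.pos
  obtain ⟨i, j, rfl, rfl | rfl⟩ := h <;> simp only [height_mk] <;> linarith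

theorem eq_or_height_lt {x y : Cylinder v u} (h : Relation.ReflTransGen Step x y) :
    x = y ∨ height x < height y := by
  induction h with
  | refl => exact Or.inl rfl
  | tail _ hs ih =>
    have := height_lt_of_step hs
    rcases ih with rfl | h
    · exact Or.inr this
    · exact Or.inr (h.trans this)

/-- The partial order on the cylinder generated by the steps. -/
instance : PartialOrder (Cylinder v u) where
  le := Relation.ReflTransGen Step
  le_refl _ := Relation.ReflTransGen.refl
  le_trans _ _ _ h h' := Relation.ReflTransGen.trans h h'
  le_antisymm x y h h' := by
    rcases eq_or_height_lt h with h | h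
    · exact h
    · rcases eq_or_height_lt h' with h' | h'
      · exact h'.symm
      · exact absurd h h'.asymm

end Cylinder

/-- A cylindric skew shape: a finite convex subposet of the cylinder. -/
structure CylindricSkewShape (v u : ℕ+) where
  /-- The boxes of the shape. -/
  cells : Finset (Cylinder v u)
  /-- If `x ≤ y ≤ z` and `x`, `z` are boxes of the shape, then so is `y`. -/
  convex : (cells : Set (Cylinder v u)).OrdConnected

namespace CylindricSkewShape

variable {v u : ℕ+}

/-- `T` is a semistandard cylindric tableau of shape `C`: it weakly increases in the rows (`j`
fixed, `i` increasing) and strictly increases in the columns (`i` fixed, `j` increasing). -/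
def IsSemistandard (C : CylindricSkewShape v u) (T : C.cells → ℕ+) : Prop :=
  (∀ (i i' j : ℤ) (h : Cylinder.mk i j ∈ C.cells) (h' : Cylinder.mk i' j ∈ C.cells),
    i < i' → T ⟨_, h⟩ ≤ T ⟨_, h'⟩) ∧
  (∀ (i j j' : ℤ) (h : Cylinder.mk i j ∈ C.cells) (h' : Cylinder.mk i j' ∈ C.cells),
    j < j' → T ⟨_, h⟩ < T ⟨_, h'⟩)

/-- The cylindric skew Schur function `s_C(x) = ∑_T ∏_{c ∈ C} x_{T(c)}`, over all semistandard
cylindric tableaux `T` of shape `C`. -/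
noncomputable def schur (C : CylindricSkewShape v u) : MvPowerSeries ℕ+ ℚ :=
  monomialSum fun T : {T : C.cells → ℕ+ // C.IsSemistandard T} => exponent (fun _ => 1) T.1

/-- The strict edges of `C`: the pairs of boxes `⟨i, j⟩`, `⟨i, j + 1⟩`. -/
def StrictEdge (C : CylindricSkewShape v u) (x y : C.cells) : Prop :=
  ∃ i j : ℤ, x.1 = Cylinder.mk i j ∧ y.1 = Cylinder.mk i (j + 1)

end CylindricSkewShape

/-! ### Skew shapes and isomorphism -/

/-- The boxes `(row, column)` of the skew shape `lam / mu`, with the componentwise order. -/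
abbrev SkewCells (lam mu : YoungDiagram) : Type :=
  {x : ℕ × ℕ // x ∈ lam.cells \ mu.cells}

/-- The strict edges of the skew shape `lam / mu`: a box and the next one in its column. -/
def SkewStrictEdge (lam mu : YoungDiagram) (x y : SkewCells lam mu) : Prop :=
  y.1 = (x.1.1 + 1, x.1.2)

/-- Isomorphism of oriented posets `(P, S)`, `(Q, S')`, where `S`, `S'` are the strict edges: a
poset isomorphism under which the strict edges correspond. The weak edges are the covering
relations that are not strict, so these correspond as well. -/
def OrientedIso {P Q : Type*} [PartialOrder P] [PartialOrder Q]
    (S : P → P → Prop) (S' : Q → Q → Prop) : Prop :=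
  ∃ φ : P ≃o Q, ∀ x y, S x y ↔ S' (φ x) (φ y)

/-- `C` is isomorphic, as an oriented poset, to some skew shape `lam / mu`. -/
def CylindricSkewShape.IsoSkewShape {v u : ℕ+} (C : CylindricSkewShape v u) : Prop :=
  ∃ lam mu : YoungDiagram, mu ≤ lam ∧ OrientedIso C.StrictEdge (SkewStrictEdge lam mu)

end CylindricSchur

namespace CylindricSchur

/-! ### Formal sums of monomials -/

/-! For skew shapes, positivity is Stanley's theory of (P, ω)-partitions. Labels that increase along
weak and decrease along strict inequalities let one sort a tableau, breaking ties by label, and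
`genFun` becomes a sum of `fundamentalQSym` of descent compositions over linear extensions
(`isFPositive_genFun`).

For the converse, `Cut` asks for a content d such that no edge of C joins contents d and d + 1
modulo u + v. A cut lets C be unrolled into the plane as a skew shape (`isoSkewShape_of_cut`). If u
= 1 the cylinder is a chain and C is always a single column (`isoSkewShape_of_one`). It remains to
refute F-positivity when u ≥ 2 and there is no cut.

The tool is `blockFunctional`, a signed sum over the ways of spreading the k top entries over
consecutive values. On a generating function it becomes a sum over prefixes T of `blockSum` of the
top level of T (`blockFunctional_genFun`). For a labelled system a sign-reversing involution
evaluates `blockSum` to (-1)^k if the level contains no weak edge, and to 0 otherwise. Hence on each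
F_α the value is (-1)^k times a count. If the count for k + 1 is nonzero, so is the count for k
obtained by moving the element of largest label into the monomial. Since signs agree, every
F-positive series inherits this: vanishing at k forces vanishing at k + 1
(`IsFPositive.blockFunctional_succ_eq_zero`).

A C without a cut violates this at k + 1 = u + v. Top levels are upper sets. One that has a cut is
labelled, and with more than v boxes it has two in one row, hence a weak edge, so it contributes 0.
One without a cut meets all u + v contents, so none has size u + v - 1, while at size u + v the only
one is the `rim`. The rim is a closed ribbon around the cylinder, and its `blockSum` is nonzero
(`blockSum_rim_ne_zero`). -/

theorem coeff_monomialSum {ι : Type*} (w : ι → (ℕ+ →₀ ℕ)) (d : ℕ+ →₀ ℕ) :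
    MvPowerSeries.coeff d (monomialSum w) = (Nat.card {a : ι // w a = d} : ℚ) := rfl

theorem monomialSum_congr {ι ι' : Type*} (e : ι ≃ ι') {w : ι → (ℕ+ →₀ ℕ)} {w' : ι' → (ℕ+ →₀ ℕ)}
    (h : ∀ a, w' (e a) = w a) : monomialSum w = monomialSum w' := by
  ext d
  rw [coeff_monomialSum, coeff_monomialSum]
  congr 1
  exact Nat.card_congr (e.subtypeEquiv fun a => by rw [h])

/-- Finiteness of the fibres matters because `Nat.card` of an infinite type is 0, which would break
additivity. -/
theorem monomialSum_sigma {κ : Type*} [Fintype κ] {ι : κ → Type*} (w : ∀ k, ι k → (ℕ+ →₀ ℕ))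
    (hw : ∀ k d, Finite {a : ι k // w k a = d}) :
    monomialSum (fun a : Σ k, ι k => w a.1 a.2) = ∑ k, monomialSum (w k) := by
  ext d
  rw [map_sum, coeff_monomialSum]
  simp only [coeff_monomialSum]
  rw [← Nat.cast_sum]
  congr 1
  have e : {a : Σ k, ι k // w a.1 a.2 = d} ≃ Σ k, {a : ι k // w k a = d} :=
    { toFun := fun a => ⟨a.1.1, a.1.2, a.2⟩
      invFun := fun a => ⟨⟨a.1, a.2.1⟩, a.2.2⟩
      left_inv := fun _ => rfl
      right_inv := fun _ => rfl }
  have := fun k => hw k d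
  rw [Nat.card_congr e, Nat.card_sigma]

theorem finite_exponent_subtype {κ : Type*} [Fintype κ] (e : κ → ℕ) (he : ∀ c, 0 < e c)
    (p : (κ → ℕ+) → Prop) (d : ℕ+ →₀ ℕ) :
    Finite {a : {T : κ → ℕ+ // p T} // exponent e a.1 = d} := by
  have := (finite_exponent_fiber e he d).to_subtype
  exact Finite.of_injective
    (fun a => (⟨a.1.1, a.2⟩ : {T : κ → ℕ+ | exponent e T = d}))
    fun a b h => Subtype.ext (Subtype.ext (congrArg (fun z => z.1) h))

/-! ### Generating functions of systems of weak and strict inequalities -/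

/-- `T` weakly increases along the pairs in `W` and strictly increases along the pairs in `S`. -/
def Compatible {P : Type*} (W S : P → P → Prop) (T : P → ℕ+) : Prop :=
  (∀ x y, W x y → T x ≤ T y) ∧ ∀ x y, S x y → T x < T y

/-- The sum of `∏ c, x_{T c}` over the maps `T` compatible with `W` and `S`. -/
noncomputable def genFun {P : Type*} [Fintype P] (W S : P → P → Prop) : MvPowerSeries ℕ+ ℚ :=
  monomialSum fun T : {T : P → ℕ+ // Compatible W S T} => exponent (fun _ => 1) T.1

theorem genFun_congr {P Q : Type*} [Fintype P] [Fintype Q] (e : P ≃ Q) {W S : P → P → Prop}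
    {W' S' : Q → Q → Prop} (h : ∀ T : Q → ℕ+, Compatible W S (T ∘ e) ↔ Compatible W' S' T) :
    genFun W S = genFun W' S' := by
  refine (monomialSum_congr ((e.arrowCongr (Equiv.refl ℕ+)).symm.subtypeEquiv
    fun T => (h T).symm) ?_).symm
  intro T
  simp only [exponent]
  exact Fintype.sum_equiv e _ _ fun c => by simp

/-! ### Fundamental quasisymmetric functions as generating functions -/

section Composition

variable {n : ℕ}

/-- Two positions lie in different blocks exactly when a boundary separates them. This turns
refinement into a statement about `index`, the form in which compositions are compared with
sequences. -/
theorem index_lt_index_iff (β : Composition n) (k k' : Fin n) :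
    β.index k < β.index k' ↔ ∃ b ∈ β.boundaries, k.val < b.val ∧ b.val ≤ k'.val := by
  constructor
  · intro h
    refine ⟨β.boundary (β.index k').castSucc, ?_, ?_, ?_⟩
    · simp [Composition.boundaries]
    · calc (k : ℕ) < β.sizeUpTo (β.index k).succ := β.lt_sizeUpTo_index_succ k
        _ ≤ _ := β.monotone_sizeUpTo (by simpa using h)
    · exact β.sizeUpTo_index_le k'
  · rintro ⟨b, hb, h1, h2⟩
    obtain ⟨m, -, rfl⟩ := Finset.mem_map.1 hb
    by_contra hlt
    rw [not_lt] at hlt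
    have e1 : β.sizeUpTo (β.index k) ≤ k := β.sizeUpTo_index_le k
    have e2 : (k' : ℕ) < β.sizeUpTo (β.index k').succ := β.lt_sizeUpTo_index_succ k'
    change k.val < β.sizeUpTo m at h1
    change β.sizeUpTo m ≤ k'.val at h2
    have hm : (β.index k : ℕ) < m := by
      by_contra hc
      have := β.monotone_sizeUpTo (not_lt.1 hc)
      omega
    have := β.monotone_sizeUpTo (show (β.index k').succ.val ≤ m by
      have := Fin.le_def.1 hlt
      simp; omega)
    omega

theorem index_mono (β : Composition n) : Monotone β.index := by
  intro k k' h
  by_contra hc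
  obtain ⟨b, -, h1, h2⟩ := (index_lt_index_iff β k' k).1 (not_le.1 hc)
  have := Fin.le_def.1 h
  omega

theorem index_surjective (β : Composition n) : Function.Surjective β.index := fun b =>
  ⟨β.embedding b ⟨0, β.one_le_blocksFun b⟩, β.index_embedding b _⟩

theorem mem_boundaries_iff (β : Composition n) (b : Fin (n + 1)) :
    b ∈ β.boundaries ↔
      ∀ k k' : Fin n, k.val < b.val → b.val ≤ k'.val → β.index k < β.index k' := by
  constructor
  · intro hb k k' h1 h2
    exact (index_lt_index_iff β k k').2 ⟨b, hb, h1, h2⟩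
  · intro h
    rcases Nat.eq_zero_or_pos b.val with h0 | h0
    · rw [show b = 0 from Fin.ext h0]
      exact β.toCompositionAsSet.zero_mem
    rcases Nat.lt_or_ge b.val n with hn | hn
    · obtain ⟨b', hb', h1, h2⟩ := (index_lt_index_iff β _ _).1
        (h ⟨b.val - 1, by omega⟩ ⟨b.val, hn⟩ (by dsimp only; omega) le_rfl)
      dsimp only at h1 h2
      rwa [show b = b' from Fin.ext (by omega)]
    · rw [show b = Fin.last n from Fin.ext (by rw [Fin.val_last]; omega)]
      exact β.toCompositionAsSet.getLast_mem

theorem composition_ext_index {β β' : Composition n}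
    (h : ∀ k k', β.index k < β.index k' ↔ β'.index k < β'.index k') : β = β' := by
  apply (compositionEquiv n).injective
  apply CompositionAsSet.ext
  change β.boundaries = β'.boundaries
  ext b
  simp only [mem_boundaries_iff, h]

theorem refines_iff_index (β γ : Composition n) :
    Refines β γ ↔ ∀ k k', γ.index k < γ.index k' → β.index k < β.index k' := by
  constructor
  · intro h k k' hk
    obtain ⟨b, hb, h1⟩ := (index_lt_index_iff γ k k').1 hk
    exact (index_lt_index_iff β k k').2 ⟨b, h hb, h1⟩
  · intro h b hb
    rw [mem_boundaries_iff] at hb ⊢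
    exact fun k k' h1 h2 => h _ _ (hb k k' h1 h2)

/-- The composition whose blocks are the level sets of a monotone map. -/
theorem exists_composition_of_monotone {L : Type*} [LinearOrder L] {g : Fin n → L}
    (hg : Monotone g) : ∃ β : Composition n, ∀ k k', β.index k < β.index k' ↔ g k < g k' := by
  classical
  let s : CompositionAsSet n :=
    { boundaries := Finset.univ.filter fun b : Fin (n + 1) =>
        ∀ k k' : Fin n, k.val < b.val → b.val ≤ k'.val → g k < g k'
      zero_mem := by simp
      getLast_mem := by
        simp only [Finset.mem_filter, Finset.mem_univ, true_and, Fin.val_last]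
        intro k k' _ h
        have := k'.2
        omega }
  refine ⟨s.toComposition, fun k k' => ?_⟩
  have hs : s.toComposition.boundaries = s.boundaries := s.toComposition_boundaries
  rw [index_lt_index_iff, hs]
  constructor
  · rintro ⟨b, hb, h1, h2⟩
    exact (Finset.mem_filter.1 hb).2 k k' h1 h2
  · intro h
    -- The separating boundary is the first position m at which g reaches the value g k'.
    have hne : (Finset.univ.filter fun m : Fin n => g k' ≤ g m).Nonempty := ⟨k', by simp⟩
    obtain ⟨m, hm, hmin⟩ := Finset.exists_min_image _ id hne
    simp only [Finset.mem_filter, Finset.mem_univ, true_and, id] at hm hmin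
    have hkm : k < m := by
      by_contra hc
      exact absurd (hm.trans (hg (not_lt.1 hc))) (not_le.2 h)
    have hmk : m ≤ k' := hmin k' le_rfl
    refine ⟨m.castSucc, ?_, by simpa using hkm, by simpa using hmk⟩
    simp only [s, Finset.mem_filter, Finset.mem_univ, true_and, Fin.val_castSucc]
    intro a a' h1 h2
    have h3 : g a < g k' := by
      by_contra hc
      have := Fin.le_def.1 (hmin a (not_lt.1 hc))
      omega
    exact h3.trans_le (hm.trans (hg (Fin.le_def.2 h2)))

theorem exponent_comp_index (β : Composition n) (j : Fin β.length → ℕ+) :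
    exponent (fun _ => 1) (j ∘ β.index) = exponent β.blocksFun j := by
  classical
  simp only [exponent]
  rw [← Finset.sum_fiberwise_of_maps_to (s := Finset.univ) (t := Finset.univ) (g := β.index)
    (fun _ _ => Finset.mem_univ _)]
  refine Finset.sum_congr rfl fun b _ => ?_
  rw [Finset.sum_congr rfl (g := fun _ => Finsupp.single (j b) 1)
    (fun k hk => by simp [(Finset.mem_filter.1 hk).2]), Finset.sum_const]
  have hc : (Finset.univ.filter fun k => β.index k = b).card = β.blocksFun b := by
    have : (Finset.univ.filter fun k => β.index k = b) =
        Finset.univ.map (β.embedding b).toEmbedding := by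
      ext k
      have := β.mem_range_embedding_iff' (j := k) (i := b)
      simp only [Set.mem_range] at this
      simp only [Finset.mem_filter, Finset.mem_univ, true_and, Finset.mem_map,
        RelEmbedding.coe_toEmbedding]
      rw [eq_comm]
      exact this.symm
    rw [this]
    simp
  rw [hc]
  simp

/-- `F_γ` is the sum of the monomials `x_{i_1} ⋯ x_{i_n}` over the weakly increasing sequences
that increase strictly from each block of `γ` to the next. -/
theorem fundamentalQSym_eq_genFun (γ : Composition n) :
    fundamentalQSym γ = genFun (fun k k' : Fin n => k < k' ∧ γ.index k = γ.index k')
      (fun k k' => γ.index k < γ.index k') := by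
  classical
  rw [fundamentalQSym, genFun, Finset.sum_subtype (p := fun β => Refines β γ) _ (fun β => by simp)]
  simp only [monomialQSym]
  let κ := {β : Composition n // Refines β γ}
  change ∑ β : κ, monomialSum (fun i : {i : Fin β.1.length → ℕ+ // StrictMono i} =>
    exponent β.1.blocksFun i.1) = _
  rw [← monomialSum_sigma _ fun β d =>
    finite_exponent_subtype β.1.blocksFun β.1.one_le_blocksFun _ d]
  have href : ∀ β : κ, ∀ k k', γ.index k < γ.index k' → β.1.index k < β.1.index k' := fun β =>
    (refines_iff_index _ _).1 β.2
  -- A weakly increasing sequence factors uniquely as a strictly increasing one after the block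
  -- index of its composition of level sets.
  let f : (Σ β : κ, {i : Fin β.1.length → ℕ+ // StrictMono i}) →
      {T : Fin n → ℕ+ // Compatible (fun k k' : Fin n => k < k' ∧ γ.index k = γ.index k')
        (fun k k' => γ.index k < γ.index k') T} := fun a =>
    ⟨a.2.1 ∘ a.1.1.index, fun k k' h => a.2.2.monotone (index_mono _ h.1.le),
      fun k k' h => a.2.2 (href a.1 k k' h)⟩
  have hf : Function.Bijective f := by
    constructor
    · rintro ⟨⟨β, hβ⟩, j, hj⟩ ⟨⟨β', hβ'⟩, j', hj'⟩ h
      have h' : j ∘ β.index = j' ∘ β'.index := congrArg Subtype.val h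
      have : β = β' := by
        refine composition_ext_index fun k k' => ?_
        rw [← hj.lt_iff_lt, ← hj'.lt_iff_lt]
        exact iff_of_eq (congrArg₂ (· < ·) (congrFun h' k) (congrFun h' k'))
      subst this
      have : j = j' := (index_surjective β).injective_comp_right h'
      subst this
      rfl
    · rintro ⟨i, hW, hS⟩
      have hi : Monotone i := by
        intro k k' h
        rcases h.eq_or_lt with rfl | h
        · exact le_rfl
        rcases (index_mono γ h.le).eq_or_lt with he | hl
        · exact hW _ _ ⟨h, he⟩
        · exact (hS _ _ hl).le
      obtain ⟨β, hβ⟩ := exists_composition_of_monotone hi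
      let s := Function.surjInv (index_surjective β)
      have hs : ∀ b, β.index (s b) = b := Function.surjInv_eq (index_surjective β)
      refine ⟨⟨⟨β, ?_⟩, fun b => i (s b), ?_⟩, ?_⟩
      · exact (refines_iff_index _ _).2 fun k k' h => (hβ k k').2 (hS _ _ h)
      · intro b b' h
        exact (hβ _ _).1 (by rwa [hs, hs])
      · apply Subtype.ext
        funext k
        change i (s (β.index k)) = i k
        have h1 := (hβ (s (β.index k)) k).not
        have h2 := (hβ k (s (β.index k))).not
        rw [hs] at h1 h2
        exact le_antisymm (not_lt.1 (h2.1 (lt_irrefl _))) (not_lt.1 (h1.1 (lt_irrefl _)))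
  exact monomialSum_congr (Equiv.ofBijective f hf) fun a => exponent_comp_index _ _

end Composition

/-! ### Labelled systems have `F`-positive generating functions -/

theorem IsFPositive.zero : IsFPositive 0 := ⟨0, fun _ => le_rfl, by simp⟩

theorem IsFPositive.add {f g : MvPowerSeries ℕ+ ℚ} (hf : IsFPositive f) (hg : IsFPositive g) :
    IsFPositive (f + g) := by
  classical
  obtain ⟨c, hc, rfl⟩ := hf
  obtain ⟨c', hc', rfl⟩ := hg
  refine ⟨c + c', fun α => add_nonneg (hc α) (hc' α), ?_⟩
  rw [Finsupp.sum_add_index']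
  · simp
  · intro a b b'
    rw [add_smul]

theorem isFPositive_fundamentalQSym {n : ℕ} (γ : Composition n) :
    IsFPositive (fundamentalQSym γ) := by
  classical
  refine ⟨Finsupp.single ⟨n, γ⟩ 1, fun α => ?_, ?_⟩
  · rw [Finsupp.single_apply]
    split_ifs <;> norm_num
  · rw [Finsupp.sum_single_index] <;> simp

/-- The compatible sequences for the system defining `F_γ`. -/
theorem fundamental_compatible_iff {n : ℕ} (γ : Composition n) (i : Fin n → ℕ+) :
    Compatible (fun k k' : Fin n => k < k' ∧ γ.index k = γ.index k')
      (fun k k' => γ.index k < γ.index k') i ↔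
    Monotone i ∧ ∀ k k', γ.index k < γ.index k' → i k < i k' := by
  constructor
  · rintro ⟨hW, hS⟩
    refine ⟨fun k k' h => ?_, hS⟩
    rcases h.eq_or_lt with rfl | h
    · exact le_rfl
    rcases (index_mono γ h.le).eq_or_lt with he | hl
    · exact hW _ _ ⟨h, he⟩
    · exact (hS _ _ hl).le
  · rintro ⟨hm, hS⟩
    exact ⟨fun k k' h => hm h.1.le, hS⟩

/-- The descent composition of a permutation. -/
theorem exists_descent_composition {n : ℕ} (σ : Equiv.Perm (Fin n)) :
    ∃ γ : Composition n, (∀ k k', k < k' → γ.index k = γ.index k' → σ k < σ k') ∧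
      ∀ k k', γ.index k < γ.index k' →
        ∃ j j' : Fin n, j.val + 1 = j'.val ∧ k ≤ j ∧ j' ≤ k' ∧ σ j' < σ j := by
  classical
  -- D k is the set of descents of σ completed by position k. Its cardinality is constant between
  -- descents, so its level sets are the blocks wanted.
  let D : Fin n → Finset (Fin n) := fun k => Finset.univ.filter fun j =>
    ∃ j' : Fin n, j.val + 1 = j'.val ∧ j' ≤ k ∧ σ j' < σ j
  have hD : ∀ k k', k ≤ k' → D k ⊆ D k' := by
    intro k k' h j hj
    simp only [D, Finset.mem_filter, Finset.mem_univ, true_and] at hj ⊢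
    obtain ⟨j', h1, h2, h3⟩ := hj
    exact ⟨j', h1, h2.trans h, h3⟩
  have hg : Monotone fun k => (D k).card := fun k k' h => Finset.card_le_card (hD k k' h)
  obtain ⟨γ, hγ⟩ := exists_composition_of_monotone hg
  refine ⟨γ, ?_, ?_⟩
  · intro k k' hk he
    have hc : D k = D k' := Finset.eq_of_subset_of_card_le (hD k k' hk.le)
      (not_lt.1 ((hγ k k').not.1 he.not_lt))
    have key : ∀ m : ℕ, ∀ a : Fin n, a.val = k.val + (m + 1) → a ≤ k' → σ k < σ a := by
      have step : ∀ j j' : Fin n, j.val + 1 = j'.val → k ≤ j → j' ≤ k' → σ j < σ j' := by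
        intro j j' h1 h2 h3
        by_contra hlt
        have hne : σ j' ≠ σ j := fun h => by
          have := congrArg Fin.val (σ.injective h)
          omega
        have hj : j ∈ D k' := by
          simp only [D, Finset.mem_filter, Finset.mem_univ, true_and]
          exact ⟨j', h1, h3, lt_of_le_of_ne (not_lt.1 hlt) hne⟩
        rw [← hc] at hj
        simp only [D, Finset.mem_filter, Finset.mem_univ, true_and] at hj
        obtain ⟨j'', h4, h5, -⟩ := hj
        have := Fin.le_def.1 h5
        have := Fin.le_def.1 h2
        omega
      intro m
      induction m with
      | zero => exact fun a ha ha' => step k a (by omega) le_rfl ha'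
      | succ m ih =>
        intro a ha ha'
        have hb : k.val + (m + 1) < n := by have := a.2; omega
        have hle : (⟨k.val + (m + 1), hb⟩ : Fin n) ≤ a := Fin.le_def.2 (by simp; omega)
        exact (ih ⟨_, hb⟩ rfl (hle.trans ha')).trans
          (step _ a (by simp; omega) (Fin.le_def.2 (by simp)) ha')
    have := Fin.lt_def.1 hk
    exact key (k'.val - k.val - 1) k' (by omega) le_rfl
  · intro k k' h
    have h' := (hγ k k').1 h
    obtain ⟨j, hj, hj'⟩ := Finset.exists_mem_notMem_of_card_lt_card h'
    simp only [D, Finset.mem_filter, Finset.mem_univ, true_and, not_exists, not_and] at hj hj'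
    obtain ⟨j', h1, h2, h3⟩ := hj
    refine ⟨j, j', h1, ?_, h2, h3⟩
    by_contra hc
    refine hj' j' h1 (Fin.le_def.2 ?_) h3
    have := Fin.lt_def.1 (not_le.1 hc)
    omega

/-- The fundamental lemma of P-partitions. Listing the elements by increasing value of T, ties by
increasing label, gives a linear extension σ. The maps with a given σ are the weakly increasing
sequences that jump at each descent of σ, and these are counted by one fundamental function. -/
theorem isFPositive_genFun_fin {n : ℕ} {W S : Fin n → Fin n → Prop}
    (hW : ∀ x y, W x y → x < y) (hS : ∀ x y, S x y → y < x) : IsFPositive (genFun W S) := by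
  classical
  choose γ hγ hγ' using fun σ : Equiv.Perm (Fin n) => exists_descent_composition σ
  let κ := {σ : Equiv.Perm (Fin n) // ∀ x y, W x y ∨ S x y → σ.symm x < σ.symm y}
  let Wγ : κ → Fin n → Fin n → Prop := fun σ k k' => k < k' ∧ (γ σ.1).index k = (γ σ.1).index k'
  let Sγ : κ → Fin n → Fin n → Prop := fun σ k k' => (γ σ.1).index k < (γ σ.1).index k'
  have hsort : ∀ (σ : κ) (i : Fin n → ℕ+), Compatible (Wγ σ) (Sγ σ) i →
      Monotone i ∧ ∀ k k', k < k' → i k = i k' → σ.1 k < σ.1 k' := by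
    intro σ i hi
    rw [fundamental_compatible_iff] at hi
    refine ⟨hi.1, fun k k' hk he => ?_⟩
    rcases (index_mono (γ σ.1) hk.le).eq_or_lt with h | h
    · exact hγ σ.1 k k' hk h
    · exact absurd he (hi.2 k k' h).ne
  let f : (Σ σ : κ, {i : Fin n → ℕ+ // Compatible (Wγ σ) (Sγ σ) i}) →
      {T : Fin n → ℕ+ // Compatible W S T} := fun a => ⟨a.2.1 ∘ a.1.1.symm, by
    obtain ⟨hm, hs⟩ := hsort a.1 a.2.1 a.2.2
    refine ⟨fun x y h => hm (a.1.2 x y (Or.inl h)).le, fun x y h => ?_⟩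
    have hlt := a.1.2 x y (Or.inr h)
    refine lt_of_le_of_ne (hm hlt.le) fun he => ?_
    have := hs _ _ hlt he
    simp only [Equiv.apply_symm_apply] at this
    exact this.asymm (hS x y h)⟩
  -- `Tuple.sort` is the unique sorting permutation that breaks ties by label, so σ can be recovered
  -- from T. This gives injectivity.
  have hσ : ∀ a, a.1.1 = Tuple.sort (f a).1 := by
    intro a
    obtain ⟨hm, hs⟩ := hsort a.1 a.2.1 a.2.2
    rw [Tuple.eq_sort_iff]
    have : (f a).1 ∘ a.1.1 = a.2.1 := by
      funext k
      simp [f]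
    refine ⟨by rw [this]; exact hm, fun k k' hk he => hs k k' hk ?_⟩
    have h1 := congrFun this k
    have h2 := congrFun this k'
    simp only [Function.comp_apply] at h1 h2
    rw [← h1, ← h2, he]
  have hf : Function.Bijective f := by
    constructor
    · intro a b h
      have h1 : a.1.1 = b.1.1 := by rw [hσ, hσ, h]
      obtain ⟨⟨σ, hσ1⟩, i, hi⟩ := a
      obtain ⟨⟨τ, hτ1⟩, i', hi'⟩ := b
      change σ = τ at h1
      subst h1
      have h2 : i ∘ σ.symm = i' ∘ σ.symm := congrArg Subtype.val h
      have : i = i' := σ.symm.surjective.injective_comp_right h2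
      subst this
      rfl
    · rintro ⟨T, hTW, hTS⟩
      obtain ⟨hm, hs⟩ := Tuple.eq_sort_iff.1 (rfl : Tuple.sort T = Tuple.sort T)
      generalize Tuple.sort T = σ at hm hs
      have hlin : ∀ x y, W x y ∨ S x y → σ.symm x < σ.symm y := by
        intro x y h
        have hxy : x ≠ y := by
          rcases h with h | h
          · exact (hW x y h).ne
          · exact (hS x y h).ne'
        by_contra hc
        have hc' : σ.symm y < σ.symm x :=
          lt_of_le_of_ne (not_lt.1 hc) fun he => hxy (σ.symm.injective he).symm
        have hle : T y ≤ T x := by simpa using hm hc'.le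
        rcases h with h | h
        · have := hs _ _ hc' (by simpa using le_antisymm hle (hTW x y h))
          simp only [Equiv.apply_symm_apply] at this
          exact this.asymm (hW x y h)
        · exact absurd (hTS x y h) (not_lt.2 hle)
      refine ⟨⟨⟨σ, hlin⟩, T ∘ σ, ?_⟩, ?_⟩
      · change Compatible (fun k k' : Fin n => k < k' ∧ (γ σ).index k = (γ σ).index k')
          (fun k k' => (γ σ).index k < (γ σ).index k') (T ∘ σ)
        rw [fundamental_compatible_iff]
        refine ⟨hm, fun k k' h => ?_⟩
        obtain ⟨j, j', h1, h2, h3, h4⟩ := hγ' σ k k' h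
        have hjj : j < j' := Fin.lt_def.2 (by omega)
        refine (hm h2).trans_lt (lt_of_lt_of_le ?_ (hm h3))
        -- Equal values would be listed by increasing label, which a descent contradicts.
        exact lt_of_le_of_ne (hm hjj.le) fun he => (hs j j' hjj he).asymm h4
      · apply Subtype.ext
        funext x
        simp [f]
  have hsum : genFun W S = ∑ σ : κ, fundamentalQSym (γ σ.1) := by
    simp only [fundamentalQSym_eq_genFun]
    unfold genFun
    rw [← monomialSum_sigma _ fun σ d => finite_exponent_subtype _ (fun _ => one_pos) _ d]
    refine (monomialSum_congr (Equiv.ofBijective f hf) fun a => ?_).symm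
    simp only [exponent]
    exact (Fintype.sum_equiv a.1.1.symm _ _ fun c => by simp [f])
  rw [hsum]
  exact Finset.sum_induction _ IsFPositive (fun _ _ => IsFPositive.add) IsFPositive.zero
    fun σ _ => isFPositive_fundamentalQSym _

/-- If the elements carry distinct labels that increase along the weak and decrease along the
strict inequalities, then the generating function is `F`-positive. -/
theorem isFPositive_genFun {P L : Type*} [Fintype P] [LinearOrder L] {W S : P → P → Prop}
    (ω : P → L) (hω : Function.Injective ω) (hW : ∀ x y, W x y → ω x < ω y)
    (hS : ∀ x y, S x y → ω y < ω x) : IsFPositive (genFun W S) := by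
  let _ : LinearOrder P := LinearOrder.lift' ω hω
  let e : P ≃o Fin (Fintype.card P) := (Fintype.orderIsoFinOfCardEq P rfl).symm
  rw [genFun_congr e.toEquiv (W' := fun a b => W (e.symm a) (e.symm b))
    (S' := fun a b => S (e.symm a) (e.symm b)) ?_]
  · refine isFPositive_genFun_fin (fun a b h => ?_) (fun a b h => ?_)
    · exact e.symm.lt_iff_lt.1 (hW _ _ h)
    · exact e.symm.lt_iff_lt.1 (hS _ _ h)
  · intro T
    constructor
    · rintro ⟨h1, h2⟩
      exact ⟨fun x y h => by simpa using h1 _ _ h, fun x y h => by simpa using h2 _ _ h⟩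
    · rintro ⟨h1, h2⟩
      exact ⟨fun x y h => h1 _ _ (by simpa using h), fun x y h => h2 _ _ (by simpa using h)⟩

/-! ### Signed sums over chains of blocks -/

section Blocks

variable {P : Type*}

/-- `B` may be the set of the smallest entries of a compatible map on `s`. -/
def Allowed (W S : P → P → Prop) (s B : Finset P) : Prop :=
  ∀ x ∈ s, ∀ y ∈ B, (W x y → x ∈ B) ∧ ¬ S x y

theorem Allowed.empty (W S : P → P → Prop) (s : Finset P) : Allowed W S s ∅ :=
  fun _ _ _ h => absurd h (Finset.notMem_empty _)

/-- No two elements of `s` are related by `W`. -/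
def Free (W : P → P → Prop) (s : Finset P) : Prop :=
  ∀ x ∈ s, ∀ y ∈ s, ¬ W x y

open Classical in
/-- The signed number of compatible maps from `s` onto an initial segment `{1, …, l}`, where the
sign is `(-1) ^ l`. -/
noncomputable def blockSum (W S : P → P → Prop) (s : Finset P) : ℚ :=
  if s = ∅ then 1 else
    -∑ B ∈ (s.powerset.filter fun B => B.Nonempty ∧ Allowed W S s B).attach,
      blockSum W S (s \ B.1)
termination_by s.card
decreasing_by
  have h := Finset.mem_filter.1 B.2
  have h1 := Finset.mem_powerset.1 h.1
  exact Finset.card_lt_card (Finset.sdiff_ssubset h1 h.2.1)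

theorem blockSum_empty (W S : P → P → Prop) : blockSum W S ∅ = 1 := by
  rw [blockSum, if_pos rfl]

open Classical in
theorem blockSum_of_nonempty [DecidableEq P] (W S : P → P → Prop) {s : Finset P} (hs : s.Nonempty) :
    blockSum W S s = -∑ B ∈ s.powerset.filter fun B => B.Nonempty ∧ Allowed W S s B,
      blockSum W S (s \ B) := by
  obtain rfl : ‹DecidableEq P› = fun a b => Classical.propDecidable (a = b) :=
    Subsingleton.elim _ _
  rw [blockSum, if_neg hs.ne_empty, Finset.sum_attach _ fun B => blockSum W S (s \ B)]

open Classical in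
-- Toggling the membership of m in B changes the sign and preserves both conditions, because no
-- W-pair leaves m and no S-pair enters it. The terms cancel in pairs.
theorem sum_powerset_allowed_eq_zero {W S : P → P → Prop} {s : Finset P} {m : P} (hm : m ∉ s)
    (hW : ∀ x ∈ insert m s, ¬ W m x) (hS : ∀ x ∈ insert m s, ¬ S x m) :
    ∑ B ∈ (insert m s).powerset, (if Allowed W S (insert m s) B ∧ Free W (insert m s \ B)
      then (-1 : ℚ) ^ (insert m s \ B).card else 0) = 0 := by
  rw [Finset.sum_powerset_insert hm, ← Finset.sum_add_distrib]
  refine Finset.sum_eq_zero fun t ht => ?_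
  have hts := Finset.mem_powerset.1 ht
  have hmt : m ∉ t := fun h => hm (hts h)
  have hiff : (Allowed W S (insert m s) t ∧ Free W (insert m s \ t)) ↔
      Allowed W S (insert m s) (insert m t) ∧ Free W (insert m s \ insert m t) := by
    constructor
    · rintro ⟨hA, hF⟩
      refine ⟨fun x hx y hy => ?_, fun x hx y hy => ?_⟩
      · rcases Finset.mem_insert.1 hy with rfl | hy
        · refine ⟨fun h => ?_, hS x hx⟩
          by_contra hc
          refine hF x ?_ y ?_ h
          · exact Finset.mem_sdiff.2 ⟨hx, fun h => hc (Finset.mem_insert_of_mem h)⟩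
          · exact Finset.mem_sdiff.2 ⟨Finset.mem_insert_self _ _, hmt⟩
        · exact ⟨fun h => Finset.mem_insert_of_mem ((hA x hx y hy).1 h), (hA x hx y hy).2⟩
      · have hsub : insert m s \ insert m t ⊆ insert m s \ t :=
          Finset.sdiff_subset_sdiff le_rfl (Finset.subset_insert _ _)
        exact hF x (hsub hx) y (hsub hy)
    · rintro ⟨hA, hF⟩
      refine ⟨fun x hx y hy => ⟨fun h => ?_, ?_⟩, fun x hx y hy h => ?_⟩
      · have := (hA x hx y (Finset.mem_insert_of_mem hy)).1 h
        rcases Finset.mem_insert.1 this with rfl | h'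
        · exact absurd h (hW y (Finset.mem_insert_of_mem (hts hy)))
        · exact h'
      · exact (hA x hx y (Finset.mem_insert_of_mem hy)).2
      · rw [Finset.mem_sdiff] at hx hy
        have hxm : x ≠ m := by
          rintro rfl
          exact hW y hy.1 h
        by_cases hym : y = m
        · subst hym
          have := (hA x hx.1 y (Finset.mem_insert_self _ _)).1 h
          rcases Finset.mem_insert.1 this with h' | h'
          · exact hxm h'
          · exact hx.2 h'
        · refine hF x ?_ y ?_ h
          · simp only [Finset.mem_sdiff, Finset.mem_insert, not_or]
            exact ⟨Finset.mem_insert.1 hx.1, hxm, hx.2⟩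
          · simp only [Finset.mem_sdiff, Finset.mem_insert, not_or]
            exact ⟨Finset.mem_insert.1 hy.1, hym, hy.2⟩
  rw [if_congr hiff.symm rfl rfl]
  split_ifs
  · have : (insert m s \ t).card = (insert m s \ insert m t).card + 1 := by
      rw [← Finset.card_insert_of_notMem (a := m) (by simp)]
      congr 1
      ext x
      simp only [Finset.mem_sdiff, Finset.mem_insert, not_or]
      by_cases hx : x = m <;> simp [hx, hmt]
    rw [this, pow_succ]
    ring
  · simp

open Classical in
/-- For labelled systems the signed sum is `± 1` or `0`. -/
theorem blockSum_of_labelled {L : Type*} [LinearOrder L] {W S : P → P → Prop} (ω : P → L)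
    (s : Finset P) (hW : ∀ x ∈ s, ∀ y ∈ s, W x y → ω x < ω y)
    (hS : ∀ x ∈ s, ∀ y ∈ s, S x y → ω y < ω x) :
    blockSum W S s = if Free W s then (-1) ^ s.card else 0 := by
  induction s using Finset.strongInduction with
  | H s ih =>
    rcases s.eq_empty_or_nonempty with rfl | hs
    · rw [blockSum_empty, if_pos, Finset.card_empty, pow_zero]
      exact fun x hx => absurd hx (Finset.notMem_empty _)
    obtain ⟨m, hm, hmax⟩ := Finset.exists_max_image s ω hs
    have key := sum_powerset_allowed_eq_zero (W := W) (S := S) (Finset.notMem_erase m s)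
      (fun x hx h => by
        rw [Finset.insert_erase hm] at hx
        exact absurd (hW m hm x hx h) (not_lt.2 (hmax x hx)))
      (fun x hx h => by
        rw [Finset.insert_erase hm] at hx
        exact absurd (hS x hx m hm h) (not_lt.2 (hmax x hx)))
    -- In the vanishing sum the term B = ∅ is the claimed value for s. The nonempty B give, by
    -- induction, the recursion that defines `blockSum`.
    rw [Finset.insert_erase hm, ← Finset.sum_erase_add _ _ (Finset.empty_mem_powerset s)] at key
    simp only [Finset.sdiff_empty, Allowed.empty, true_and] at key
    suffices h : ∑ B ∈ s.powerset.filter (fun B => B.Nonempty ∧ Allowed W S s B),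
        blockSum W S (s \ B) = ∑ B ∈ s.powerset.erase ∅,
          if Allowed W S s B ∧ Free W (s \ B) then (-1) ^ (s \ B).card else 0 by
      rw [blockSum_of_nonempty W S hs, h]
      linarith
    have herase : s.powerset.erase ∅ = s.powerset.filter fun B => B.Nonempty := by
      ext B
      rw [Finset.mem_erase, Finset.mem_filter, Finset.nonempty_iff_ne_empty, and_comm]
    rw [herase, ← Finset.filter_filter, Finset.sum_filter]
    refine Finset.sum_congr rfl fun B hB => ?_
    rw [Finset.mem_filter, Finset.mem_powerset] at hB
    have hsub : s \ B ⊆ s := Finset.sdiff_subset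
    by_cases hA : Allowed W S s B
    · rw [if_pos hA, ih _ (Finset.sdiff_ssubset hB.1 hB.2)
        (fun x hx y hy => hW x (hsub hx) y (hsub hy))
        (fun x hx y hy => hS x (hsub hx) y (hsub hy))]
      exact if_congr (by simp [hA]) rfl rfl
    · rw [if_neg hA, if_neg (fun h => hA h.1)]

end Blocks

/-! ### The block functionals -/

/-- The linear functional which extracts the coefficients of the monomials `x ^ d * x ^ e`, where
`e` has degree `k` and support `{q, …, q + l - 1}` for some `l`, with the sign `(-1) ^ l`. -/
noncomputable def blockFunctional (k : ℕ) (q : ℕ+) (d : ℕ+ →₀ ℕ) :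
    MvPowerSeries ℕ+ ℚ →ₗ[ℚ] ℚ :=
  if k = 0 then MvPowerSeries.coeff d else
    -∑ b : Fin k, blockFunctional b (q + 1) (d + Finsupp.single q (k - b))
termination_by k
decreasing_by exact b.2

theorem add_single_apply_eq_zero {q : ℕ+} {d : ℕ+ →₀ ℕ} (hd : ∀ r, q ≤ r → d r = 0) (b : ℕ) :
    ∀ r, q + 1 ≤ r → (d + Finsupp.single q b : ℕ+ →₀ ℕ) r = 0 := fun r hr => by
  have hlt : q < q + 1 := PNat.lt_add_right q 1
  rw [Finsupp.add_apply, hd r (hlt.le.trans hr), Finsupp.single_apply,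
    if_neg (hlt.trans_le hr).ne, add_zero]

section Prefix

variable {P : Type*} [Fintype P]

/-- The elements on which `T` takes the value `q`. -/
def level (q : ℕ+) (T : P → ℕ+) : Finset P := Finset.univ.filter fun c => T c = q

theorem mem_level {q : ℕ+} {T : P → ℕ+} {c : P} : c ∈ level q T ↔ T c = q := by
  simp [level]

/-- `T` is the truncation at `q` of a compatible map with `k` values at least `q`, in which each
`r < q` occurs `d r` times. -/
structure IsPrefix (W S : P → P → Prop) (k : ℕ) (q : ℕ+) (d : ℕ+ →₀ ℕ) (T : P → ℕ+) : Prop where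
  le : ∀ c, T c ≤ q
  card_level : (level q T).card = k
  card_level_lt : ∀ r < q, (level r T).card = d r
  weak : ∀ x y, W x y → T x ≤ T y
  strict : ∀ x y, S x y → T x < T y ∨ T x = q ∧ T y = q

open Classical in
/-- The finite set of all prefixes. -/
noncomputable def prefixes (W S : P → P → Prop) (k : ℕ) (q : ℕ+) (d : ℕ+ →₀ ℕ) :
    Finset (P → ℕ+) :=
  (Fintype.piFinset fun _ => Finset.Icc 1 q).filter fun T => IsPrefix W S k q d T

theorem mem_prefixes {W S : P → P → Prop} {k : ℕ} {q : ℕ+} {d : ℕ+ →₀ ℕ} {T : P → ℕ+} :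
    T ∈ prefixes W S k q d ↔ IsPrefix W S k q d T := by
  simp only [prefixes, Finset.mem_filter, Fintype.mem_piFinset, Finset.mem_Icc, and_iff_right_iff_imp]
  exact fun h c => ⟨one_le, h.le c⟩

theorem exponent_apply (T : P → ℕ+) (r : ℕ+) :
    exponent (fun _ => 1) T r = (level r T).card := by
  classical
  simp only [exponent, Finsupp.finsetSum_apply, Finsupp.single_apply, level, Finset.card_filter]

open Classical in
/-- Move the elements outside `B` with value `q` to `q + 1`. -/
noncomputable def raise {Q : Type*} (q : ℕ+) (B : Finset Q) (T : Q → ℕ+) (c : Q) : ℕ+ :=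
  if T c = q ∧ c ∉ B then q + 1 else T c

theorem level_raise {q : ℕ+} {B : Finset P} {T : P → ℕ+} (hB : B ⊆ level q T) :
    level q (raise q B T) = B := by
  have hlt : q < q + 1 := PNat.lt_add_right q 1
  ext c
  rw [mem_level, raise]
  split_ifs with hc
  · simp [hc.2, hlt.ne']
  · constructor
    · intro h1
      by_contra h2
      exact hc ⟨h1, h2⟩
    · exact fun h1 => mem_level.1 (hB h1)

open Classical in
theorem level_succ_raise {q : ℕ+} {B : Finset P} {T : P → ℕ+} (h : ∀ c, T c ≤ q) :
    level (q + 1) (raise q B T) = level q T \ B := by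
  have hlt : q < q + 1 := PNat.lt_add_right q 1
  ext c
  rw [Finset.mem_sdiff, mem_level, mem_level, raise]
  split_ifs with hc
  · simp [hc]
  · constructor
    · intro h1
      exact absurd h1 ((h c).trans_lt hlt).ne
    · exact fun h1 => absurd h1 hc

/-- One refinement of a truncation: B keeps the value q and the rest of the level moves up.
`Allowed` is what keeps the inequalities valid. `IsPrefix.min` is the inverse operation, and
together they match the recursion of `blockFunctional` with that of `blockSum`. -/
theorem IsPrefix.raise {W S : P → P → Prop} {k : ℕ} {q : ℕ+} {d : ℕ+ →₀ ℕ} {T : P → ℕ+}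
    (h : IsPrefix W S k q d T) {B : Finset P} (hB : B ⊆ level q T)
    (hA : Allowed W S (level q T) B) (hd : d q = 0) {b : ℕ} (hb : b + B.card = k) :
    IsPrefix W S b (q + 1) (d + Finsupp.single q B.card) (raise q B T) := by
  classical
  have hlt : q < q + 1 := PNat.lt_add_right q 1
  refine ⟨fun c => ?_, ?_, fun r hr => ?_, fun x y hxy => ?_, fun x y hxy => ?_⟩
  · rw [CylindricSchur.raise]
    split_ifs
    · exact le_rfl
    · exact (h.le c).trans hlt.le
  · have := h.card_level
    rw [level_succ_raise h.le, Finset.card_sdiff_of_subset hB]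
    omega
  · rw [Finsupp.add_apply, Finsupp.single_apply]
    rcases (PNat.lt_add_one_iff.1 hr).eq_or_lt with rfl | hr'
    · rw [if_pos rfl, hd, zero_add]
      rw [level_raise hB]
    · rw [if_neg hr'.ne', add_zero, ← h.card_level_lt r hr']
      congr 1
      ext c
      rw [mem_level, mem_level, CylindricSchur.raise]
      split_ifs with hc
      · simp [hc.1, hr'.ne', (hr'.trans hlt).ne']
      · rfl
  · have h1 := h.weak x y hxy
    have h2 := h.le y
    unfold CylindricSchur.raise
    split_ifs with hx hy hy
    · exact le_rfl
    · exfalso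
      have hyq : T y = q := le_antisymm h2 (hx.1 ▸ h1)
      have hyB : y ∈ B := by
        by_contra hc
        exact hy ⟨hyq, hc⟩
      exact hx.2 ((hA x (mem_level.2 hx.1) y hyB).1 hxy)
    · exact (h.le x).trans hlt.le
    · exact h1
  · have h1 := h.strict x y hxy
    have h2 := h.le y
    unfold CylindricSchur.raise
    split_ifs with hx hy hy
    · exact Or.inr ⟨rfl, rfl⟩
    · have hyq : T y = q := by
        rcases h1 with h1 | h1
        · exact absurd (hx.1 ▸ h1) (not_lt.2 h2)
        · exact h1.2
      have hyB : y ∈ B := by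
        by_contra hc
        exact hy ⟨hyq, hc⟩
      exact absurd hxy (hA x (mem_level.2 hx.1) y hyB).2
    · exact Or.inl ((h.le x).trans_lt hlt)
    · rcases h1 with h1 | h1
      · exact Or.inl h1
      · have hyB : y ∈ B := by
          by_contra hc
          exact hy ⟨h1.2, hc⟩
        exact absurd hxy (hA x (mem_level.2 h1.1) y hyB).2

theorem min_raise {Q : Type*} {q : ℕ+} {B : Finset Q} {T : Q → ℕ+} (h : ∀ c, T c ≤ q) (c : Q) :
    min (raise q B T c) q = T c := by
  rw [raise]
  split_ifs with hc
  · rw [hc.1]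
    exact min_eq_right (PNat.lt_add_right q 1).le
  · exact min_eq_left (h c)

theorem raise_min {q : ℕ+} {T : P → ℕ+} (h : ∀ c, T c ≤ q + 1) :
    raise q (level q T) (fun c => min (T c) q) = T := by
  have hlt : q < q + 1 := PNat.lt_add_right q 1
  funext c
  rw [raise]
  rcases (h c).eq_or_lt with h1 | h1
  · rw [if_pos, h1]
    rw [mem_level, h1]
    exact ⟨min_eq_right hlt.le, hlt.ne'⟩
  · have := PNat.lt_add_one_iff.1 h1
    rw [if_neg, min_eq_left this]
    rw [min_eq_left this, mem_level]
    tauto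

theorem level_min {q : ℕ+} {T : P → ℕ+} :
    level q (fun c => min (T c) q) = Finset.univ.filter fun c => q ≤ T c := by
  ext c
  simp [mem_level]

theorem IsPrefix.min {W S : P → P → Prop} {k b : ℕ} {q : ℕ+} {d : ℕ+ →₀ ℕ} {T : P → ℕ+}
    (hd : d q = 0) (hb : b < k)
    (h : IsPrefix W S b (q + 1) (d + Finsupp.single q (k - b)) T) :
    IsPrefix W S k q d (fun c => min (T c) q) ∧ (level q T).card = k - b ∧
      level q T ⊆ level q (fun c => min (T c) q) ∧
      Allowed W S (level q fun c => min (T c) q) (level q T) := by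
  classical
  have hlt : q < q + 1 := PNat.lt_add_right q 1
  have hcard : (level q T).card = k - b := by
    have := h.card_level_lt q hlt
    simpa [hd] using this
  have hsplit : level q (fun c => Min.min (T c) q) = level (q + 1) T ∪ level q T := by
    rw [level_min]
    ext c
    have h1 := h.le c
    rw [Finset.mem_union, mem_level, mem_level, Finset.mem_filter]
    constructor
    · rintro ⟨-, h2⟩
      rcases h1.eq_or_lt with h3 | h3
      · exact Or.inl h3
      · exact Or.inr (le_antisymm (PNat.lt_add_one_iff.1 h3) h2)
    · rintro (h2 | h2)
      · exact ⟨Finset.mem_univ _, h2 ▸ hlt.le⟩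
      · exact ⟨Finset.mem_univ _, h2.ge⟩
  refine ⟨⟨fun c => min_le_right _ _, ?_, fun r hr => ?_, fun x y hxy => ?_, fun x y hxy => ?_⟩,
    hcard, ?_, fun x hx y hy => ⟨fun hxy => ?_, fun hxy => ?_⟩⟩
  · rw [hsplit, Finset.card_union_of_disjoint, h.card_level, hcard]
    · omega
    · rw [Finset.disjoint_left]
      intro c h1 h2
      rw [mem_level] at h1 h2
      exact hlt.ne (h2.symm.trans h1)
  · have := h.card_level_lt r (hr.trans hlt)
    rw [Finsupp.add_apply, Finsupp.single_apply, if_neg hr.ne', add_zero] at this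
    rw [← this]
    congr 1
    ext c
    rw [mem_level, mem_level]
    rcases le_total (T c) q with h1 | h1
    · rw [min_eq_left h1]
    · rw [min_eq_right h1]
      exact ⟨fun h2 => absurd h2 hr.ne', fun h2 => absurd (h2 ▸ h1) (not_le.2 hr)⟩
  · exact min_le_min_right q (h.weak x y hxy)
  · rcases h.strict x y hxy with h1 | h1
    · rcases lt_or_ge (T x) q with h2 | h2
      · left
        rw [min_eq_left h2.le]
        exact lt_min h1 h2
      · right
        exact ⟨min_eq_right h2, min_eq_right (h2.trans h1.le)⟩
    · right
      rw [h1.1, h1.2]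
      exact ⟨min_eq_right hlt.le, min_eq_right hlt.le⟩
  · rw [hsplit]
    exact Finset.subset_union_right
  · rw [level_min, Finset.mem_filter] at hx
    rw [mem_level] at hy ⊢
    exact le_antisymm (hy ▸ h.weak x y hxy) hx.2
  · rw [level_min, Finset.mem_filter] at hx
    rw [mem_level] at hy
    rcases h.strict x y hxy with h1 | h1
    · exact absurd (hy ▸ h1) (not_lt.2 hx.2)
    · exact hlt.ne (hy.symm.trans h1.2)

/-- With k = 0 nothing sits at level q, so the exception in the strict condition is void and
prefixes are genuine compatible maps. -/
theorem coeff_genFun_eq_card_prefixes {W S : P → P → Prop} {q : ℕ+} {d : ℕ+ →₀ ℕ}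
    (hd : ∀ r, q ≤ r → d r = 0) :
    MvPowerSeries.coeff d (genFun W S) = (prefixes W S 0 q d).card := by
  rw [genFun, coeff_monomialSum, ← Nat.card_eq_finsetCard]
  congr 1
  refine Nat.card_congr
    { toFun := fun a => ⟨a.1.1, mem_prefixes.2 ?_⟩
      invFun := fun T => ⟨⟨T.1, ?_⟩, ?_⟩
      left_inv := fun _ => rfl
      right_inv := fun _ => rfl }
  · have hc : ∀ r, (level r a.1.1).card = d r := fun r => by rw [← exponent_apply, a.2]
    have hlt : ∀ c, a.1.1 c < q := by
      intro c
      by_contra hq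
      have h1 := hc (a.1.1 c)
      rw [hd _ (not_lt.1 hq), Finset.card_eq_zero] at h1
      exact Finset.notMem_empty c (h1 ▸ mem_level.2 rfl)
    exact ⟨fun c => (hlt c).le, by rw [hc, hd q le_rfl], fun r _ => hc r, a.1.2.1,
      fun x y h => Or.inl (a.1.2.2 x y h)⟩
  · have hT := mem_prefixes.1 T.2
    refine ⟨hT.weak, fun x y h => ?_⟩
    rcases hT.strict x y h with h1 | h1
    · exact h1
    · have h2 := Finset.card_eq_zero.1 hT.card_level
      exact absurd (mem_level.2 h1.1) (h2 ▸ Finset.notMem_empty x)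
  · have hT := mem_prefixes.1 T.2
    ext r
    change exponent (fun _ => 1) T.1 r = d r
    rw [exponent_apply]
    rcases lt_or_ge r q with hr | hr
    · exact hT.card_level_lt r hr
    · rw [hd r hr]
      rcases hr.eq_or_lt with rfl | hr
      · exact hT.card_level
      · rw [Finset.card_eq_zero, Finset.eq_empty_iff_forall_notMem]
        intro c hc
        exact absurd (hT.le c) (not_le.2 (mem_level.1 hc ▸ hr))

theorem blockFunctional_genFun (W S : P → P → Prop) (k : ℕ) : ∀ (q : ℕ+) (d : ℕ+ →₀ ℕ)
    (_ : ∀ r, q ≤ r → d r = 0), blockFunctional k q d (genFun W S) =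
      ∑ T ∈ prefixes W S k q d, blockSum W S (level q T) := by
  classical
  induction k using Nat.strong_induction_on with
  | _ k ih =>
  intro q d hd
  rcases Nat.eq_zero_or_pos k with rfl | hk
  · rw [blockFunctional, if_pos rfl, coeff_genFun_eq_card_prefixes hd, Finset.card_eq_sum_ones,
      Nat.cast_sum]
    refine Finset.sum_congr rfl fun T hT => ?_
    rw [Finset.card_eq_zero.1 (mem_prefixes.1 hT).card_level, blockSum_empty, Nat.cast_one]
  rw [blockFunctional, if_neg hk.ne', LinearMap.neg_apply, LinearMap.sum_apply]
  have h1 : ∀ b : Fin k, blockFunctional b (q + 1) (d + Finsupp.single q (k - b)) (genFun W S) =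
      ∑ T ∈ prefixes W S b (q + 1) (d + Finsupp.single q (k - b)),
        blockSum W S (level (q + 1) T) := fun b =>
    ih b b.2 _ _ (add_single_apply_eq_zero hd _)
  have h2 : ∀ T ∈ prefixes W S k q d, blockSum W S (level q T) =
      -∑ B ∈ (level q T).powerset.filter fun B => B.Nonempty ∧ Allowed W S (level q T) B,
        blockSum W S (level q T \ B) := fun T hT => by
    refine blockSum_of_nonempty W S ?_
    rw [← Finset.card_pos, (mem_prefixes.1 hT).card_level]
    exact hk
  rw [Finset.sum_congr rfl fun b _ => h1 b, Finset.sum_congr rfl h2, Finset.sum_neg_distrib,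
    neg_inj, Finset.sum_sigma', Finset.sum_sigma']
  symm
  refine Finset.sum_bij'
    (i := fun a ha => ⟨⟨k - a.2.card, ?_⟩, raise q a.2 a.1⟩)
    (j := fun a _ => ⟨fun c => min (a.2 c) q, level q a.2⟩) ?_ ?_ ?_ ?_ ?_
  · have := (Finset.mem_filter.1 (Finset.mem_sigma.1 ha).2).2.1.card_pos
    omega
  · rintro ⟨T, B⟩ ha
    simp only [Finset.mem_sigma, Finset.mem_filter, Finset.mem_powerset, mem_prefixes,
      Finset.mem_univ, true_and] at ha ⊢
    obtain ⟨hT, hB, hne, hA⟩ := ha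
    have hBk : B.card ≤ k := hT.card_level ▸ Finset.card_le_card hB
    have := hT.raise hB hA (hd q le_rfl) (b := k - B.card) (by omega)
    rwa [show k - (k - B.card) = B.card by omega]
  · rintro ⟨b, T⟩ ha
    simp only [Finset.mem_sigma, Finset.mem_filter, Finset.mem_powerset, mem_prefixes,
      Finset.mem_univ, true_and] at ha ⊢
    obtain ⟨h3, h4, h5, h6⟩ := ha.min (hd q le_rfl) b.2
    refine ⟨h3, h5, ?_, h6⟩
    rw [← Finset.card_pos, h4]
    have := b.2
    omega
  · rintro ⟨T, B⟩ ha
    simp only [Finset.mem_sigma, Finset.mem_filter, Finset.mem_powerset, mem_prefixes] at ha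
    obtain ⟨hT, hB, hne, hA⟩ := ha
    have e1 : (fun c => min (raise q B T c) q) = T := funext fun c => min_raise hT.le c
    have e2 : level q (raise q B T) = B := level_raise hB
    simp only [e1, e2]
  · rintro ⟨b, T⟩ ha
    simp only [Finset.mem_sigma, mem_prefixes, Finset.mem_univ, true_and] at ha
    obtain ⟨h3, h4, h5, h6⟩ := ha.min (hd q le_rfl) b.2
    have e1 : raise q (level q T) (fun c => min (T c) q) = T := raise_min ha.le
    have e2 : (⟨k - (level q T).card, by rw [h4]; have := b.2; omega⟩ : Fin k) = b := by
      apply Fin.ext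
      have := b.2
      simp only [h4]
      omega
    simp only [e1]
    exact Sigma.ext e2 HEq.rfl
  · rintro ⟨T, B⟩ ha
    simp only [Finset.mem_sigma, Finset.mem_filter, Finset.mem_powerset, mem_prefixes] at ha
    rw [level_succ_raise ha.1.le]

open Classical in
theorem blockFunctional_of_labelled {L : Type*} [LinearOrder L] {W S : P → P → Prop} (ω : P → L)
    (hW : ∀ x y, W x y → ω x < ω y) (hS : ∀ x y, S x y → ω y < ω x) (k : ℕ) {q : ℕ+}
    {d : ℕ+ →₀ ℕ} (hd : ∀ r, q ≤ r → d r = 0) :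
    blockFunctional k q d (genFun W S) =
      (-1) ^ k * ((prefixes W S k q d).filter fun T => Free W (level q T)).card := by
  rw [blockFunctional_genFun W S k q d hd, Finset.card_filter, Nat.cast_sum, Finset.mul_sum]
  refine Finset.sum_congr rfl fun T hT => ?_
  rw [blockSum_of_labelled ω _ (fun x _ y _ => hW x y) (fun x _ y _ => hS x y),
    (mem_prefixes.1 hT).card_level]
  split_ifs <;> simp

/-- The element m of largest label may stay alone at value q: freeness rules out weak pairs ending
at m, and maximality of its label rules out strict ones. The rest of the level is still free. -/
theorem exists_free_prefix_succ {L : Type*} [LinearOrder L] {W S : P → P → Prop} (ω : P → L)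
    (hS : ∀ x y, S x y → ω y < ω x) {k : ℕ} {q : ℕ+} {d : ℕ+ →₀ ℕ} (hd : d q = 0) {T : P → ℕ+}
    (hT : IsPrefix W S (k + 1) q d T) (hF : Free W (level q T)) :
    ∃ T', IsPrefix W S k (q + 1) (d + Finsupp.single q 1) T' ∧ Free W (level (q + 1) T') := by
  classical
  have hne : (level q T).Nonempty := by
    rw [← Finset.card_pos, hT.card_level]
    omega
  obtain ⟨m, hm, hmax⟩ := Finset.exists_max_image (level q T) ω hne
  have hA : Allowed W S (level q T) {m} := by
    intro x hx y hy
    rw [Finset.mem_singleton] at hy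
    subst hy
    exact ⟨fun h => absurd h (hF x hx y hm), fun h => absurd (hS x y h) (not_lt.2 (hmax x hx))⟩
  refine ⟨raise q {m} T, hT.raise (Finset.singleton_subset_iff.2 hm) hA hd (by simp), ?_⟩
  rw [level_succ_raise hT.le]
  exact fun x hx y hy => hF x (Finset.mem_sdiff.1 hx).1 y (Finset.mem_sdiff.1 hy).1

end Prefix

/-! ### The necessary condition for F-positivity -/

theorem blockFunctional_fundamentalQSym {n : ℕ} (γ : Composition n) (q : ℕ+) {d : ℕ+ →₀ ℕ}
    (hd : ∀ r, q ≤ r → d r = 0) (k : ℕ) :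
    (0 ≤ (-1) ^ k * blockFunctional k q d (fundamentalQSym γ)) ∧
      (blockFunctional k (q + 1) (d + Finsupp.single q 1) (fundamentalQSym γ) = 0 →
        blockFunctional (k + 1) q d (fundamentalQSym γ) = 0) := by
  classical
  -- Strict pairs go to a later block, so blocks are labelled in reverse order; weak pairs stay in
  -- one block, where labels follow positions.
  let ω : Fin n → (Fin γ.length)ᵒᵈ ×ₗ Fin n := fun k => toLex (OrderDual.toDual (γ.index k), k)
  have hW : ∀ x y : Fin n, (x < y ∧ γ.index x = γ.index y) → ω x < ω y := fun x y h =>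
    Prod.Lex.toLex_lt_toLex.2 (Or.inr ⟨by rw [h.2], h.1⟩)
  have hS : ∀ x y : Fin n, γ.index x < γ.index y → ω y < ω x := fun x y h =>
    Prod.Lex.toLex_lt_toLex.2 (Or.inl (OrderDual.toDual_lt_toDual.2 h))
  have hd' := add_single_apply_eq_zero hd 1
  rw [fundamentalQSym_eq_genFun, blockFunctional_of_labelled ω hW hS k hd,
    blockFunctional_of_labelled ω hW hS k hd', blockFunctional_of_labelled ω hW hS (k + 1) hd]
  constructor
  · rw [← mul_assoc, ← mul_pow]
    simp
  · intro h
    have h0 : ((-1 : ℚ)) ^ k ≠ 0 := pow_ne_zero _ (by norm_num)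
    have h1 := (mul_eq_zero.1 h).resolve_left h0
    rw [Nat.cast_eq_zero, Finset.card_eq_zero, Finset.eq_empty_iff_forall_notMem] at h1
    rw [Finset.filter_eq_empty_iff.2, Finset.card_empty, Nat.cast_zero, mul_zero]
    intro T hT hF
    obtain ⟨T', hT', hF'⟩ := exists_free_prefix_succ ω hS (hd q le_rfl) (mem_prefixes.1 hT) hF
    exact h1 T' (Finset.mem_filter.2 ⟨mem_prefixes.2 hT', hF'⟩)

/-- After multiplication by (-1)^k all terms are nonnegative, so a vanishing sum forces each of them
to vanish, and the implication applies to each F_α separately. -/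
theorem IsFPositive.blockFunctional_succ_eq_zero {f : MvPowerSeries ℕ+ ℚ} (hf : IsFPositive f)
    {k : ℕ} {q : ℕ+} {d : ℕ+ →₀ ℕ} (hd : ∀ r, q ≤ r → d r = 0)
    (h : blockFunctional k (q + 1) (d + Finsupp.single q 1) f = 0) :
    blockFunctional (k + 1) q d f = 0 := by
  obtain ⟨c, hc, rfl⟩ := hf
  have hd' := add_single_apply_eq_zero hd 1
  simp only [Finsupp.sum, map_sum, map_smul, smul_eq_mul] at h ⊢
  have h' : ∑ α ∈ c.support, c α * ((-1) ^ k *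
      blockFunctional k (q + 1) (d + Finsupp.single q 1) (fundamentalQSym α.2)) = 0 := by
    rw [← mul_zero ((-1 : ℚ) ^ k), ← h, Finset.mul_sum]
    exact Finset.sum_congr rfl fun α _ => by ring
  rw [Finset.sum_eq_zero_iff_of_nonneg fun α _ => mul_nonneg (hc α)
    (blockFunctional_fundamentalQSym α.2 (q + 1) hd' k).1] at h'
  refine Finset.sum_eq_zero fun α hα => ?_
  rcases mul_eq_zero.1 (h' α hα) with h1 | h1
  · rw [h1, zero_mul]
  · have h0 : ((-1 : ℚ)) ^ k ≠ 0 := pow_ne_zero _ (by norm_num)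
    rw [(blockFunctional_fundamentalQSym α.2 q hd k).2 ((mul_eq_zero.1 h1).resolve_left h0),
      mul_zero]

/-! ### Lattice points and lifts -/

namespace Cylinder

variable {v u : ℕ+}

theorem mk_eq_mk_iff {i j i' j' : ℤ} : (mk i j : Cylinder v u) = mk i' j' ↔
    ∃ k : ℤ, i' = i - k * (u : ℕ) ∧ j' = j + k * (v : ℕ) := by
  refine (QuotientAddGroup.eq (s := AddSubgroup.zmultiples
    ((-((u : ℕ) : ℤ), ((v : ℕ) : ℤ)) : ℤ × ℤ)) (a := (i, j)) (b := (i', j'))).trans ?_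
  rw [AddSubgroup.mem_zmultiples_iff]
  refine exists_congr fun k => ?_
  rw [Prod.ext_iff]
  simp only [Prod.smul_mk, smul_eq_mul, Prod.fst_add, Prod.snd_add, Prod.fst_neg, Prod.snd_neg]
  constructor
  · rintro ⟨h1, h2⟩
    constructor <;> linarith
  · rintro ⟨h1, h2⟩
    constructor <;> linarith

theorem exists_eq_mk (x : Cylinder v u) : ∃ i j, x = mk i j := by
  obtain ⟨⟨i, j⟩, rfl⟩ := QuotientAddGroup.mk_surjective x
  exact ⟨i, j, rfl⟩

theorem mk_add_congr {i j i' j' : ℤ} (h : (mk i j : Cylinder v u) = mk i' j') (p q : ℤ) :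
    (mk (i + p) (j + q) : Cylinder v u) = mk (i' + p) (j' + q) := by
  obtain ⟨k, h1, h2⟩ := mk_eq_mk_iff.1 h
  exact mk_eq_mk_iff.2 ⟨k, by linarith, by linarith⟩

theorem mk_le_mk {i j i' j' : ℤ} (hi : i ≤ i') (hj : j ≤ j') :
    (mk i j : Cylinder v u) ≤ mk i' j' := by
  have h1 : (mk i j : Cylinder v u) ≤ mk i' j := by
    induction i', hi using Int.leInduction with
    | base => exact le_rfl
    | succ m _ ih => exact ih.trans (Relation.ReflTransGen.single ⟨m, j, rfl, Or.inl rfl⟩)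
  refine h1.trans ?_
  induction j', hj using Int.leInduction with
  | base => exact le_rfl
  | succ m _ ih => exact ih.trans (Relation.ReflTransGen.single ⟨i', m, rfl, Or.inr rfl⟩)

theorem exists_mk_of_le {x y : Cylinder v u} (h : x ≤ y) {i j : ℤ} (hx : x = mk i j) :
    ∃ i' j', y = mk i' j' ∧ i ≤ i' ∧ j ≤ j' := by
  change Relation.ReflTransGen Step x y at h
  induction h with
  | refl => exact ⟨i, j, hx, le_rfl, le_rfl⟩
  | tail _ hs ih =>
    obtain ⟨a, b, hab, h1, h2⟩ := ih
    obtain ⟨p, q, hpq, hz⟩ := hs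
    rw [hpq] at hab
    rcases hz with rfl | rfl
    · refine ⟨a + 1, b, ?_, by linarith, h2⟩
      simpa using mk_add_congr hab 1 0
    · refine ⟨a, b + 1, ?_, h1, by linarith⟩
      simpa using mk_add_congr hab 0 1

/-- The right neighbour relation. -/
def Right (x y : Cylinder v u) : Prop := ∃ i j, x = mk i j ∧ y = mk (i + 1) j

/-- The lower neighbour relation. -/
def Below (x y : Cylinder v u) : Prop := ∃ i j, x = mk i j ∧ y = mk i (j + 1)

theorem Right.le {x y : Cylinder v u} (h : Right x y) : x ≤ y := by
  obtain ⟨i, j, rfl, rfl⟩ := h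
  exact mk_le_mk (by linarith) le_rfl

theorem Below.le {x y : Cylinder v u} (h : Below x y) : x ≤ y := by
  obtain ⟨i, j, rfl, rfl⟩ := h
  exact mk_le_mk le_rfl (by linarith)

theorem Right.eq_mk {x y : Cylinder v u} (h : Right x y) {i j : ℤ} (hx : x = mk i j) :
    y = mk (i + 1) j := by
  obtain ⟨a, b, rfl, rfl⟩ := h
  simpa using mk_add_congr hx 1 0

theorem Below.eq_mk {x y : Cylinder v u} (h : Below x y) {i j : ℤ} (hx : x = mk i j) :
    y = mk i (j + 1) := by
  obtain ⟨a, b, rfl, rfl⟩ := h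
  simpa using mk_add_congr hx 0 1

theorem Right.height_eq {x y : Cylinder v u} (h : Right x y) :
    height y = height x + (v : ℕ) := by
  obtain ⟨i, j, rfl, rfl⟩ := h
  rw [height_mk, height_mk]
  ring

theorem Below.height_eq {x y : Cylinder v u} (h : Below x y) :
    height y = height x + (u : ℕ) := by
  obtain ⟨i, j, rfl, rfl⟩ := h
  rw [height_mk, height_mk]
  ring

/-- The period (-u, v) changes j - i by u + v, so a half-open window of that length contains one
representative. -/
theorem exists_eq_mk_content (x : Cylinder v u) (d : ℤ) :
    ∃ p : ℤ × ℤ, x = mk p.1 p.2 ∧ d < p.2 - p.1 ∧ p.2 - p.1 ≤ d + ((u : ℕ) + (v : ℕ)) := by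
  obtain ⟨i, j, rfl⟩ := exists_eq_mk x
  have hN : (0 : ℤ) < (u : ℕ) + (v : ℕ) := by
    have := u.pos
    positivity
  set N : ℤ := (u : ℕ) + (v : ℕ)
  obtain ⟨k, ⟨h1, h2⟩, -⟩ := existsUnique_add_zsmul_mem_Ioc hN (j - i) d
  rw [smul_eq_mul] at h1 h2
  refine ⟨(i - k * (u : ℕ), j + k * (v : ℕ)), mk_eq_mk_iff.2 ⟨k, rfl, rfl⟩, ?_, ?_⟩
  · have : k * N = k * (u : ℕ) + k * (v : ℕ) := mul_add _ _ _
    dsimp only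
    linarith
  · have : k * N = k * (u : ℕ) + k * (v : ℕ) := mul_add _ _ _
    dsimp only
    linarith

theorem mk_eq_mk_of_content {i j i' j' : ℤ} (h : (mk i j : Cylinder v u) = mk i' j')
    (h1 : j - i < j' - i' + ((u : ℕ) + (v : ℕ))) (h2 : j' - i' < j - i + ((u : ℕ) + (v : ℕ))) :
    i = i' ∧ j = j' := by
  obtain ⟨k, rfl, rfl⟩ := mk_eq_mk_iff.1 h
  have hN : (0 : ℤ) < (u : ℕ) + (v : ℕ) := by
    have := u.pos
    positivity
  set N : ℤ := (u : ℕ) + (v : ℕ)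
  have hk : k * N = k * (u : ℕ) + k * (v : ℕ) := mul_add _ _ _
  have : k = 0 := by
    have h3 : k < 1 := by
      by_contra hc
      have := mul_le_mul_of_nonneg_right (not_lt.1 hc) hN.le
      linarith
    have h4 : -1 < k := by
      by_contra hc
      have := mul_le_mul_of_nonneg_right (not_lt.1 hc) hN.le
      linarith
    omega
  subst this
  simp

/-- The representative of `x` whose content `j - i` lies in `(d, d + u + v]`. -/
noncomputable def lift (d : ℤ) (x : Cylinder v u) : ℤ × ℤ := (exists_eq_mk_content x d).choose

theorem mk_lift (d : ℤ) (x : Cylinder v u) : mk (lift d x).1 (lift d x).2 = x :=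
  (exists_eq_mk_content x d).choose_spec.1.symm

theorem lt_content_lift (d : ℤ) (x : Cylinder v u) : d < (lift d x).2 - (lift d x).1 :=
  (exists_eq_mk_content x d).choose_spec.2.1

theorem content_lift_le (d : ℤ) (x : Cylinder v u) :
    (lift d x).2 - (lift d x).1 ≤ d + ((u : ℕ) + (v : ℕ)) :=
  (exists_eq_mk_content x d).choose_spec.2.2

theorem lift_mk {d i j : ℤ} (h1 : d < j - i) (h2 : j - i ≤ d + ((u : ℕ) + (v : ℕ))) :
    lift d (mk i j : Cylinder v u) = (i, j) := by
  have h3 := lt_content_lift d (mk i j : Cylinder v u)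
  have h4 := content_lift_le d (mk i j : Cylinder v u)
  have := mk_eq_mk_of_content (mk_lift d (mk i j : Cylinder v u)) (by linarith) (by linarith)
  exact Prod.ext this.1 this.2

/-- No step joins elements of `Q` with contents `d` and `d + 1`, modulo `u + v`. -/
def Cut (Q : Set (Cylinder v u)) (d : ℤ) : Prop :=
  ∀ i j, j - i = d → mk i j ∈ Q → mk i (j + 1) ∉ Q ∧ mk (i - 1) j ∉ Q

/-- A right step lowers the content by 1. It could leave the window only from content d + 1 to d,
which the cut forbids. -/
theorem Cut.lift_right {Q : Set (Cylinder v u)} {d : ℤ} (h : Cut Q d) {x y : Cylinder v u}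
    (hx : x ∈ Q) (hy : y ∈ Q) (hxy : Right x y) :
    lift d y = ((lift d x).1 + 1, (lift d x).2) := by
  have hy' := hxy.eq_mk (mk_lift d x).symm
  have h1 := lt_content_lift d x
  have h2 := content_lift_le d x
  rw [← mk_lift d x] at hx
  generalize lift d x = p at *
  rw [hy'] at hy ⊢
  apply lift_mk
  · by_contra hc
    refine (h (p.1 + 1) p.2 (by linarith) hy).2 ?_
    rwa [add_sub_cancel_right]
  · linarith

theorem Cut.lift_below {Q : Set (Cylinder v u)} {d : ℤ} (h : Cut Q d) {x y : Cylinder v u}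
    (hx : x ∈ Q) (hy : y ∈ Q) (hxy : Below x y) :
    lift d y = ((lift d x).1, (lift d x).2 + 1) := by
  have hy' := hxy.eq_mk (mk_lift d x).symm
  have h1 := lt_content_lift d x
  have h2 := content_lift_le d x
  rw [← mk_lift d x] at hx
  generalize lift d x = p at *
  rw [hy'] at hy ⊢
  apply lift_mk
  · linarith
  · by_contra hc
    -- Here x has content d + u + v, the top of the window; one period brings it to content d, where
    -- the cut applies.
    have hshift : ∀ a b : ℤ, (mk a b : Cylinder v u) = mk (a + (u : ℕ)) (b - (v : ℕ)) := by
      intro a b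
      exact mk_eq_mk_iff.2 ⟨-1, by ring, by ring⟩
    rw [hshift] at hx hy
    refine (h _ _ (by linarith) hx).1 ?_
    rwa [show p.2 - ((v : ℕ) : ℤ) + 1 = p.2 + 1 - (v : ℕ) by ring]

/-- Lifting commutes with each step inside the rectangle, so a path to the opposite corner lifts to
the plane. Convexity of the unrolled shape follows from this. -/
theorem Cut.lift_mk_add {Q : Set (Cylinder v u)} {d : ℤ} (h : Cut Q d) {i j : ℤ} (a b : ℕ)
    (hQ : ∀ i' j', i ≤ i' → i' ≤ i + a → j ≤ j' → j' ≤ j + b → mk i' j' ∈ Q)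
    (hl : lift d (mk i j : Cylinder v u) = (i, j)) :
    lift d (mk (i + a) (j + b) : Cylinder v u) = (i + a, j + b) := by
  have h1 : ∀ a' : ℕ, a' ≤ a → lift d (mk (i + a') j : Cylinder v u) = (i + a', j) := by
    intro a'
    induction a' with
    | zero => simp [hl]
    | succ m ih =>
      intro hm
      have ih := ih (by omega)
      have := h.lift_right (hQ (i + m) j (by omega) (by omega) (by omega) (by omega))
        (hQ (i + m + 1) j (by omega) (by omega) (by omega) (by omega)) ⟨_, _, rfl, rfl⟩
      rw [ih] at this
      push_cast
      rwa [← add_assoc]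
  have h2 : ∀ b' : ℕ, b' ≤ b → lift d (mk (i + a) (j + b') : Cylinder v u) = (i + a, j + b') := by
    intro b'
    induction b' with
    | zero => simpa using h1 a le_rfl
    | succ m ih =>
      intro hm
      have ih := ih (by omega)
      have := h.lift_below (hQ (i + a) (j + m) (by omega) (by omega) (by omega) (by omega))
        (hQ (i + a) (j + m + 1) (by omega) (by omega) (by omega) (by omega)) ⟨_, _, rfl, rfl⟩
      rw [ih] at this
      push_cast
      rwa [← add_assoc]
  exact h2 b le_rfl

/-- A label that increases along right steps and decreases along downward steps. -/
noncomputable def label (d : ℤ) (x : Cylinder v u) : ℤ ×ₗ ℤᵒᵈ :=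
  toLex ((lift d x).1, OrderDual.toDual (lift d x).2)

theorem Cut.label_lt_of_right {Q : Set (Cylinder v u)} {d : ℤ} (h : Cut Q d) {x y : Cylinder v u}
    (hx : x ∈ Q) (hy : y ∈ Q) (hxy : Right x y) : label d x < label d y := by
  rw [label, label, h.lift_right hx hy hxy]
  exact Prod.Lex.toLex_lt_toLex.2 (Or.inl (lt_add_one _))

theorem Cut.label_lt_of_below {Q : Set (Cylinder v u)} {d : ℤ} (h : Cut Q d) {x y : Cylinder v u}
    (hx : x ∈ Q) (hy : y ∈ Q) (hxy : Below x y) : label d y < label d x := by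
  rw [label, label, h.lift_below hx hy hxy]
  exact Prod.Lex.toLex_lt_toLex.2 (Or.inr ⟨rfl, OrderDual.toDual_lt_toDual.2 (lt_add_one _)⟩)

end Cylinder

/-! ### Shapes that are isomorphic to skew shapes -/

namespace CylindricSkewShape

variable {v u : ℕ+} {C : CylindricSkewShape v u}

theorem mem_of_le {x y z : Cylinder v u} (C : CylindricSkewShape v u) (hx : x ∈ C.cells)
    (hz : z ∈ C.cells) (h1 : x ≤ y) (h2 : y ≤ z) : y ∈ C.cells :=
  C.convex.out (Finset.mem_coe.2 hx) (Finset.mem_coe.2 hz) ⟨h1, h2⟩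

theorem strictEdge_iff {x y : C.cells} : C.StrictEdge x y ↔ Cylinder.Below x.1 y.1 := Iff.rfl

/-- A relation that holds along the steps in `C`, reflexive and transitive, holds along `≤`. -/
theorem rel_of_le {r : C.cells → C.cells → Prop} (hr : ∀ x, r x x)
    (ht : ∀ x y z, r x y → r y z → r x z) (hR : ∀ x y : C.cells, Cylinder.Right x.1 y.1 → r x y)
    (hB : ∀ x y : C.cells, Cylinder.Below x.1 y.1 → r x y) {x y : C.cells} (h : x ≤ y) :
    r x y := by
  have h' : Relation.ReflTransGen Cylinder.Step x.1 y.1 := h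
  obtain ⟨x, hx⟩ := x
  dsimp only at h'
  induction h' using Relation.ReflTransGen.head_induction_on with
  | refl => exact hr y
  | head hs hz ih =>
    have hle : ∀ {a b : Cylinder v u}, Relation.ReflTransGen Cylinder.Step a b → a ≤ b := id
    have hmem := C.mem_of_le hx y.2 (hle (Relation.ReflTransGen.single hs)) (hle hz)
    refine ht _ ⟨_, hmem⟩ _ ?_ (ih hmem (hle hz))
    obtain ⟨i, j, h1, h2 | h2⟩ := hs
    · exact hR _ _ ⟨i, j, h1, h2⟩
    · exact hB _ _ ⟨i, j, h1, h2⟩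

/-- By convexity, a chain of steps between two boxes of C stays in C, so conditions on whole rows
and columns reduce to neighbours. -/
theorem isSemistandard_iff_monotone {T : C.cells → ℕ+} :
    C.IsSemistandard T ↔ Monotone T ∧ ∀ x y, C.StrictEdge x y → T x < T y := by
  constructor
  · rintro ⟨h1, h2⟩
    have hB : ∀ x y : C.cells, Cylinder.Below x.1 y.1 → T x < T y := by
      rintro ⟨x, hx⟩ ⟨y, hy⟩ ⟨i, j, h3, h4⟩
      dsimp only at h3 h4
      subst h3 h4
      exact h2 i j (j + 1) hx hy (lt_add_one _)
    refine ⟨fun x y h => ?_, hB⟩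
    refine rel_of_le (r := fun x y => T x ≤ T y) (fun _ => le_rfl) (fun _ _ _ => le_trans) ?_
      (fun x y h => (hB x y h).le) h
    rintro ⟨x, hx⟩ ⟨y, hy⟩ ⟨i, j, h3, h4⟩
    dsimp only at h3 h4
    subst h3 h4
    exact h1 i (i + 1) j hx hy (lt_add_one _)
  · rintro ⟨h1, h2⟩
    refine ⟨fun i i' j h h' hi => h1 (Cylinder.mk_le_mk hi.le le_rfl), fun i j j' h h' hj => ?_⟩
    have hm : Cylinder.mk i (j + 1) ∈ C.cells := C.mem_of_le h h'
      (Cylinder.mk_le_mk le_rfl (by linarith)) (Cylinder.mk_le_mk le_rfl hj)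
    exact (h2 ⟨_, h⟩ ⟨_, hm⟩ ⟨i, j, rfl, rfl⟩).trans_le
      (h1 (Cylinder.mk_le_mk le_rfl hj))

theorem isSemistandard_iff_compatible {T : C.cells → ℕ+} : C.IsSemistandard T ↔
    Compatible (fun x y : C.cells => Cylinder.Right x.1 y.1) (fun x y => Cylinder.Below x.1 y.1)
      T := by
  rw [isSemistandard_iff_monotone]
  constructor
  · rintro ⟨h1, h2⟩
    exact ⟨fun x y h => h1 h.le, h2⟩
  · rintro ⟨h1, h2⟩
    exact ⟨fun x y h => rel_of_le (r := fun x y => T x ≤ T y) (fun _ => le_rfl)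
      (fun _ _ _ => le_trans) h1 (fun x y h => (h2 x y h).le) h, h2⟩

theorem schur_eq_genFun {W S : C.cells → C.cells → Prop}
    (h : ∀ T, C.IsSemistandard T ↔ Compatible W S T) : C.schur = genFun W S :=
  monomialSum_congr (Equiv.subtypeEquivRight h) fun _ => rfl

/-- A shape that embeds into the plane, compatibly with the strict edges, is a skew shape. -/
theorem isoSkewShape_of_embedding (φ : C.cells → ℤ × ℤ) (hφ : ∀ x y, φ x ≤ φ y ↔ x ≤ y)
    (hconv : (Set.range φ).OrdConnected)
    (hS : ∀ x y, C.StrictEdge x y ↔ φ y = ((φ x).1, (φ x).2 + 1)) : C.IsoSkewShape := by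
  classical
  obtain ⟨m, hm⟩ : ∃ m : ℤ, ∀ x, m ≤ (φ x).1 ∧ m ≤ (φ x).2 := by
    obtain ⟨a, ha⟩ := (Set.finite_range fun x => (φ x).1).bddBelow
    obtain ⟨b, hb⟩ := (Set.finite_range fun x => (φ x).2).bddBelow
    exact ⟨min a b, fun x => ⟨(min_le_left _ _).trans (ha ⟨x, rfl⟩),
      (min_le_right _ _).trans (hb ⟨x, rfl⟩)⟩⟩
  -- The coordinates are swapped, since j is the row and i the column, and translated to be
  -- nonnegative.
  let ψ : C.cells → ℕ × ℕ := fun x => (((φ x).2 - m).toNat, ((φ x).1 - m).toNat)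
  have hψ : ∀ x, φ x = (((ψ x).2 : ℤ) + m, ((ψ x).1 : ℤ) + m) := by
    intro x
    have := hm x
    apply Prod.ext
    · dsimp only [ψ]; omega
    · dsimp only [ψ]; omega
  have hψle : ∀ x y, ψ x ≤ ψ y ↔ x ≤ y := by
    intro x y
    rw [← hφ, hψ x, hψ y, Prod.le_def, Prod.le_def]
    dsimp only
    omega
  let s : Finset (ℕ × ℕ) := Finset.univ.image ψ
  have hs : ∀ {p q r : ℕ × ℕ}, p ∈ s → r ∈ s → p ≤ q → q ≤ r → q ∈ s := by
    intro p q r hp hr h1 h2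
    obtain ⟨x, -, rfl⟩ := Finset.mem_image.1 hp
    obtain ⟨y, -, rfl⟩ := Finset.mem_image.1 hr
    have hq : ((q.2 : ℤ) + m, (q.1 : ℤ) + m) ∈ Set.range φ := by
      refine hconv.out ⟨x, rfl⟩ ⟨y, rfl⟩ ⟨?_, ?_⟩
      · rw [hψ x, Prod.le_def]
        have := Prod.le_def.1 h1
        dsimp only
        omega
      · rw [hψ y, Prod.le_def]
        have := Prod.le_def.1 h2
        dsimp only
        omega
    obtain ⟨z, hz⟩ := hq
    refine Finset.mem_image.2 ⟨z, Finset.mem_univ _, ?_⟩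
    rw [hψ z, Prod.ext_iff] at hz
    dsimp only at hz
    apply Prod.ext <;> omega
  let lam : YoungDiagram := ⟨s.biUnion Finset.Iic, by
    intro p q h hp
    simp only [Finset.coe_biUnion, Set.mem_iUnion, Finset.mem_coe, Finset.coe_Iic, Set.mem_Iic] at hp ⊢
    obtain ⟨r, hr, hpr⟩ := hp
    exact ⟨r, hr, le_trans h hpr⟩⟩
  have hlam : ∀ p, p ∈ lam.cells ↔ ∃ r ∈ s, p ≤ r := fun p => by simp [lam]
  -- The lower closure of s with s removed is again a lower set because s is convex.
  let mu : YoungDiagram := ⟨lam.cells \ s, by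
    intro p q h hp
    rw [Finset.mem_coe, Finset.mem_sdiff, hlam] at hp ⊢
    obtain ⟨⟨r, hr, hpr⟩, hps⟩ := hp
    exact ⟨⟨r, hr, le_trans h hpr⟩, fun hq => hps (hs hq hr h hpr)⟩⟩
  have hmem : ∀ p, p ∈ lam.cells \ mu.cells ↔ p ∈ s := by
    intro p
    change p ∈ lam.cells \ (lam.cells \ s) ↔ p ∈ s
    simp only [Finset.mem_sdiff, hlam, not_and, not_not]
    exact ⟨fun h => h.2 h.1, fun h => ⟨⟨p, h, le_rfl⟩, fun _ => h⟩⟩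
  have hle : mu ≤ lam := by
    change lam.cells \ s ⊆ lam.cells
    exact Finset.sdiff_subset
  let f : C.cells → SkewCells lam mu := fun x =>
    ⟨ψ x, (hmem _).2 (Finset.mem_image_of_mem _ (Finset.mem_univ _))⟩
  have hf : Function.Bijective f := by
    constructor
    · intro x y h
      have h' : ψ x = ψ y := congrArg Subtype.val h
      exact le_antisymm ((hψle x y).1 h'.le) ((hψle y x).1 h'.ge)
    · rintro ⟨p, hp⟩
      obtain ⟨x, -, rfl⟩ := Finset.mem_image.1 ((hmem p).1 hp)
      exact ⟨x, rfl⟩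
  refine ⟨lam, mu, hle, ⟨Equiv.ofBijective f hf, fun {x y} => hψle x y⟩, fun x y => ?_⟩
  rw [hS, hψ x, hψ y]
  change _ ↔ ψ y = ((ψ x).1 + 1, (ψ x).2)
  rw [Prod.ext_iff, Prod.ext_iff]
  dsimp only
  omega

theorem isoSkewShape_of_cut {d : ℤ} (h : Cylinder.Cut (C.cells : Set (Cylinder v u)) d) :
    C.IsoSkewShape := by
  refine isoSkewShape_of_embedding (fun x => Cylinder.lift d x.1) (fun x y => ⟨fun hxy => ?_,
    fun hxy => ?_⟩) ⟨?_⟩ (fun x y => ⟨fun hxy => h.lift_below x.2 y.2 hxy, fun hxy => ?_⟩)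
  · change x.1 ≤ y.1
    rw [← Cylinder.mk_lift d x.1, ← Cylinder.mk_lift d y.1]
    exact Cylinder.mk_le_mk hxy.1 hxy.2
  · refine rel_of_le (r := fun x y : C.cells => Cylinder.lift d x.1 ≤ Cylinder.lift d y.1)
      (fun _ => le_rfl) (fun _ _ _ => le_trans) (fun x y hxy => ?_) (fun x y hxy => ?_) hxy
    · rw [h.lift_right x.2 y.2 hxy]
      exact ⟨by simp, le_rfl⟩
    · rw [h.lift_below x.2 y.2 hxy]
      exact ⟨le_rfl, by simp⟩
  · rintro _ ⟨x, rfl⟩ _ ⟨y, rfl⟩ z ⟨hz1, hz2⟩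
    obtain ⟨a, ha⟩ := Int.le.dest hz1.1
    obtain ⟨b, hb⟩ := Int.le.dest hz1.2
    have hQ : ∀ i' j', (Cylinder.lift d x.1).1 ≤ i' → i' ≤ (Cylinder.lift d x.1).1 + a →
        (Cylinder.lift d x.1).2 ≤ j' → j' ≤ (Cylinder.lift d x.1).2 + b →
        Cylinder.mk i' j' ∈ (C.cells : Set (Cylinder v u)) := by
      intro i' j' h1 h2 h3 h4
      refine C.mem_of_le x.2 y.2 ?_ ?_
      · rw [← Cylinder.mk_lift d x.1]
        exact Cylinder.mk_le_mk h1 h3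
      · rw [← Cylinder.mk_lift d y.1]
        exact Cylinder.mk_le_mk ((h2.trans_eq ha).trans hz2.1) ((h4.trans_eq hb).trans hz2.2)
    have hz := h.lift_mk_add a b hQ (by rw [Cylinder.mk_lift])
    rw [ha, hb] at hz
    exact ⟨⟨Cylinder.mk z.1 z.2, hQ _ _ hz1.1 ha.ge hz1.2 hb.ge⟩, hz⟩
  · refine ⟨(Cylinder.lift d x.1).1, (Cylinder.lift d x.1).2, (Cylinder.mk_lift d x.1).symm, ?_⟩
    rw [← Cylinder.mk_lift d y.1, hxy]

/-- For u = 1 every class has a representative in the column i = 0, and `height` is its row. A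
convex set is an interval of this chain; its horizontal inequalities follow from the vertical ones.
-/
theorem isoSkewShape_of_one {C : CylindricSkewShape v 1} : C.IsoSkewShape := by
  have hmk : ∀ x : Cylinder v 1, Cylinder.mk 0 (Cylinder.height x) = x := by
    intro x
    obtain ⟨i, j, rfl⟩ := Cylinder.exists_eq_mk x
    rw [Cylinder.height_mk]
    exact Cylinder.mk_eq_mk_iff.2 ⟨-i, by simp, by push_cast; ring⟩
  have hh : ∀ m : ℤ, Cylinder.height (Cylinder.mk 0 m : Cylinder v 1) = m := fun m => by
    rw [Cylinder.height_mk]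
    simp
  refine isoSkewShape_of_embedding (fun x => (0, Cylinder.height x.1)) (fun x y => ⟨fun hxy => ?_,
    fun hxy => ?_⟩) ⟨?_⟩ (fun x y => ⟨fun hxy => ?_, fun hxy => ?_⟩)
  · change x.1 ≤ y.1
    rw [← hmk x.1, ← hmk y.1]
    exact Cylinder.mk_le_mk le_rfl hxy.2
  · refine ⟨le_rfl, ?_⟩
    rcases Cylinder.eq_or_height_lt (show Relation.ReflTransGen Cylinder.Step x.1 y.1 from hxy)
      with h | h
    · exact (congrArg _ h).le
    · exact h.le
  · rintro _ ⟨x, rfl⟩ _ ⟨y, rfl⟩ ⟨z1, z2⟩ ⟨hz1, hz2⟩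
    have h0 : z1 = 0 := le_antisymm hz2.1 hz1.1
    subst h0
    refine ⟨⟨Cylinder.mk 0 z2, C.mem_of_le x.2 y.2 ?_ ?_⟩, ?_⟩
    · rw [← hmk x.1]
      exact Cylinder.mk_le_mk le_rfl hz1.2
    · rw [← hmk y.1]
      exact Cylinder.mk_le_mk le_rfl hz2.2
    · dsimp only
      rw [hh]
  · have := (strictEdge_iff.1 hxy).height_eq
    simpa using this
  · refine ⟨0, Cylinder.height x.1, (hmk x.1).symm, ?_⟩
    rw [← hmk y.1]
    exact congrArg _ (Prod.ext_iff.1 hxy).2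

theorem SkewCells.le_of_le {lam mu : YoungDiagram} {T : SkewCells lam mu → ℕ+}
    (h1 : ∀ x y : SkewCells lam mu, y.1 = (x.1.1, x.1.2 + 1) → T x ≤ T y)
    (h2 : ∀ x y, SkewStrictEdge lam mu x y → T x < T y) {x y : SkewCells lam mu} (h : x ≤ y) :
    T x ≤ T y := by
  have key : ∀ n : ℕ, ∀ x : SkewCells lam mu, x ≤ y →
      (y.1.1 - x.1.1) + (y.1.2 - x.1.2) = n → T x ≤ T y := by
    intro n
    induction n with
    | zero =>
      intro x hx hn
      have h3 := Prod.le_def.1 (show x.1 ≤ y.1 from hx)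
      have : x = y := Subtype.ext (Prod.ext (by omega) (by omega))
      rw [this]
    | succ n ih =>
      intro x hx hn
      have h3 := Prod.le_def.1 (show x.1 ≤ y.1 from hx)
      have hmem : ∀ p, x.1 ≤ p → p ≤ y.1 → p ∈ lam.cells \ mu.cells := by
        intro p hp1 hp2
        have hx' := Finset.mem_sdiff.1 x.2
        have hy' := Finset.mem_sdiff.1 y.2
        refine Finset.mem_sdiff.2 ⟨lam.isLowerSet hp2 hy'.1, fun hc => hx'.2 ?_⟩
        exact mu.isLowerSet hp1 hc
      rcases Nat.lt_or_ge x.1.2 y.1.2 with h4 | h4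
      · have hp := hmem (x.1.1, x.1.2 + 1) ⟨le_rfl, Nat.le_succ _⟩ ⟨h3.1, h4⟩
        exact (h1 x ⟨_, hp⟩ rfl).trans (ih ⟨_, hp⟩ ⟨h3.1, h4⟩ (by dsimp only; omega))
      · have h5 : x.1.1 < y.1.1 := by omega
        have hp := hmem (x.1.1 + 1, x.1.2) ⟨Nat.le_succ _, le_rfl⟩ ⟨h5, h3.2⟩
        exact (h2 x ⟨_, hp⟩ rfl).le.trans (ih ⟨_, hp⟩ ⟨h5, h3.2⟩ (by dsimp only; omega))
  exact key _ x h rfl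

theorem IsoSkewShape.isFPositive (h : C.IsoSkewShape) : IsFPositive C.schur := by
  obtain ⟨lam, mu, -, φ, hφ⟩ := h
  -- The weak pairs are pulled back from λ/μ. The isomorphism need not carry horizontal neighbours
  -- of C to horizontal neighbours: for u = 1 the image can be a single column.
  let W : C.cells → C.cells → Prop := fun x y => (φ y).1 = ((φ x).1.1, (φ x).1.2 + 1)
  have hiff : ∀ T, C.IsSemistandard T ↔ Compatible W C.StrictEdge T := by
    intro T
    rw [isSemistandard_iff_monotone]
    constructor
    · rintro ⟨h1, h2⟩
      refine ⟨fun x y hxy => h1 (φ.le_iff_le.1 ?_), h2⟩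
      change (φ x).1 ≤ (φ y).1
      rw [hxy]
      exact ⟨le_rfl, Nat.le_succ _⟩
    · rintro ⟨h1, h2⟩
      refine ⟨fun x y hxy => ?_, h2⟩
      have := SkewCells.le_of_le (T := T ∘ φ.symm) (fun a b hab => h1 _ _ (by simpa [W] using hab))
        (fun a b hab => h2 _ _ ((hφ _ _).2 (by simpa using hab))) (φ.le_iff_le.2 hxy)
      simpa using this
  rw [schur_eq_genFun hiff]
  let ω : C.cells → ℕ ×ₗ ℕᵒᵈ := fun x => toLex ((φ x).1.2, OrderDual.toDual (φ x).1.1)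
  refine isFPositive_genFun ω ?_ ?_ ?_
  · intro x y hxy
    have h1 := Prod.ext_iff.1 (toLex.injective hxy)
    exact φ.injective (Subtype.ext (Prod.ext (OrderDual.toDual.injective h1.2) h1.1))
  · intro x y hxy
    refine Prod.Lex.toLex_lt_toLex.2 (Or.inl ?_)
    dsimp only
    rw [hxy]
    exact Nat.lt_succ_self _
  · intro x y hxy
    have h1 : (φ y).1 = ((φ x).1.1 + 1, (φ x).1.2) := (hφ x y).1 hxy
    refine Prod.Lex.toLex_lt_toLex.2 (Or.inr ?_)
    dsimp only
    rw [h1]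
    exact ⟨rfl, OrderDual.toDual_lt_toDual.2 (Nat.lt_succ_self _)⟩

end CylindricSkewShape

/-! ### Contents and shapes that wrap around the cylinder -/

namespace Cylinder

variable {v u : ℕ+}

/-- The content `j - i` of `⟨i, j⟩`, modulo `u + v`. -/
def content : Cylinder v u → ZMod ((u : ℕ) + v) :=
  QuotientAddGroup.lift (AddSubgroup.zmultiples ((-((u : ℕ) : ℤ), ((v : ℕ) : ℤ)) : ℤ × ℤ))
    ((Int.castAddHom (ZMod ((u : ℕ) + v))).comp (AddMonoidHom.snd ℤ ℤ - AddMonoidHom.fst ℤ ℤ)) (by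
    rw [AddSubgroup.zmultiples_le, AddMonoidHom.mem_ker]
    have : ((((u : ℕ) + v : ℕ) : ℤ) : ZMod ((u : ℕ) + v)) = 0 := by
      rw [Int.cast_natCast]
      exact ZMod.natCast_self _
    change (((v : ℕ) - -((u : ℕ) : ℤ) : ℤ) : ZMod ((u : ℕ) + v)) = 0
    rw [← this]
    push_cast
    ring)

theorem content_mk (i j : ℤ) :
    content (mk i j : Cylinder v u) = ((j - i : ℤ) : ZMod ((u : ℕ) + v)) := rfl

theorem Right.content_eq {x y : Cylinder v u} (h : Right x y) : content y = content x - 1 := by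
  obtain ⟨i, j, rfl, rfl⟩ := h
  rw [content_mk, content_mk]
  push_cast
  ring

theorem Below.content_eq {x y : Cylinder v u} (h : Below x y) : content y = content x + 1 := by
  obtain ⟨i, j, rfl, rfl⟩ := h
  rw [content_mk, content_mk]
  push_cast
  ring

theorem exists_mk_of_content_eq {y : Cylinder v u} {d : ℤ}
    (h : content y = (d : ZMod ((u : ℕ) + v))) : ∃ i, y = mk i (i + d) := by
  obtain ⟨i, j, rfl⟩ := exists_eq_mk y
  rw [content_mk, ZMod.intCast_eq_intCast_iff_dvd_sub] at h
  obtain ⟨k, hk⟩ := h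
  push_cast at hk
  exact ⟨i - k * (u : ℕ), mk_eq_mk_iff.2 ⟨k, rfl, by linarith⟩⟩

/-- The diagonal successor `⟨i + 1, j + 1⟩` of `⟨i, j⟩`. -/
noncomputable def diag (x : Cylinder v u) : Cylinder v u := mk ((lift 0 x).1 + 1) ((lift 0 x).2 + 1)

theorem diag_mk (i j : ℤ) : diag (mk i j : Cylinder v u) = mk (i + 1) (j + 1) :=
  mk_add_congr (mk_lift 0 _) 1 1

theorem le_diag (x : Cylinder v u) : x ≤ diag x := by
  obtain ⟨i, j, rfl⟩ := exists_eq_mk x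
  rw [diag_mk]
  exact mk_le_mk (by linarith) (by linarith)

theorem diag_mono {x y : Cylinder v u} (h : x ≤ y) : diag x ≤ diag y := by
  obtain ⟨i, j, rfl⟩ := exists_eq_mk x
  obtain ⟨i', j', rfl, h1, h2⟩ := exists_mk_of_le h rfl
  rw [diag_mk, diag_mk]
  exact mk_le_mk (by linarith) (by linarith)

theorem content_diag (x : Cylinder v u) : content (diag x) = content x := by
  obtain ⟨i, j, rfl⟩ := exists_eq_mk x
  rw [diag_mk, content_mk, content_mk]
  congr 1
  ring

theorem height_lt_height_diag (x : Cylinder v u) : height x < height (diag x) := by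
  obtain ⟨i, j, rfl⟩ := exists_eq_mk x
  rw [diag_mk, height_mk, height_mk]
  have hu : (0 : ℤ) < (u : ℕ) := by exact_mod_cast u.pos
  have hv : (0 : ℤ) < (v : ℕ) := by exact_mod_cast v.pos
  linarith

theorem exists_content_eq_of_not_cut {Q : Set (Cylinder v u)} (h : ∀ d, ¬ Cut Q d)
    (c : ZMod ((u : ℕ) + v)) : ∃ x ∈ Q, content x = c := by
  obtain ⟨d, rfl⟩ := ZMod.intCast_surjective c
  have := h d
  simp only [Cut, not_forall] at this
  obtain ⟨i, j, hij, hQ, -⟩ := this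
  exact ⟨_, hQ, by rw [content_mk, hij]⟩

theorem cut_of_content_ne {Q : Set (Cylinder v u)} (d : ℤ)
    (h : ∀ x ∈ Q, content x ≠ (d : ZMod ((u : ℕ) + v))) : Cut Q d := by
  intro i j hij hQ
  exact absurd (by rw [content_mk, hij]) (h _ hQ)

end Cylinder

namespace CylindricSkewShape

open Cylinder

variable {v u : ℕ+} {C : CylindricSkewShape v u}

/-! ### Sets of boxes with and without a cut -/

instance : NeZero ((u : ℕ) + (v : ℕ)) := ⟨by have := u.pos; omega⟩

/-- The relation of horizontal neighbours in `C`. -/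
def WeakEdge (C : CylindricSkewShape v u) (x y : C.cells) : Prop := Right x.1 y.1

/-- Pigeonhole: the cylinder has v rows, so two boxes share one, and convexity puts the right
neighbour of the left box in Q. -/
theorem not_free_of_card_lt {Q : Finset C.cells}
    (hQ : ∀ x ∈ Q, ∀ y, x ≤ y → ∀ z ∈ Q, y ≤ z → y ∈ Q) (hcard : (v : ℕ) < Q.card) :
    ¬ Free C.WeakEdge Q := by
  intro hF
  have hv : (0 : ℤ) < (v : ℕ) := by exact_mod_cast v.pos
  obtain ⟨x, hx, y, hy, hne, he⟩ := Finset.exists_ne_map_eq_of_card_lt_of_maps_to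
    (t := Finset.Ico (0 : ℤ) (v : ℕ)) (f := fun x : C.cells => (lift 0 x.1).2 % ((v : ℕ) : ℤ))
    (by simpa using hcard)
    (fun x _ => Finset.mem_coe.2 (Finset.mem_Ico.2
      ⟨Int.emod_nonneg _ hv.ne', Int.emod_lt_of_pos _ hv⟩))
  have key : ∀ x ∈ Q, ∀ y ∈ Q, ∀ i i' j, i < i' → x.1 = Cylinder.mk i j → y.1 = Cylinder.mk i' j → False := by
    intro x hx y hy i i' j hi h1 h2
    have hxz : x.1 ≤ Cylinder.mk (i + 1) j := by
      rw [h1]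
      exact mk_le_mk (by linarith) le_rfl
    have hzy : Cylinder.mk (i + 1) j ≤ y.1 := by
      rw [h2]
      exact mk_le_mk hi le_rfl
    have hz := C.mem_of_le x.2 y.2 hxz hzy
    exact hF x hx ⟨_, hz⟩ (hQ x hx ⟨_, hz⟩ hxz y hy hzy) ⟨i, j, h1, rfl⟩
  obtain ⟨k, hk⟩ := Int.ModEq.dvd he
  have hx1 := (mk_lift 0 x.1).symm
  have hy1 : y.1 = Cylinder.mk ((lift 0 y.1).1 + k * (u : ℕ)) (lift 0 x.1).2 := by
    conv_lhs => rw [← mk_lift 0 y.1]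
    exact mk_eq_mk_iff.2 ⟨-k, by ring, by linarith⟩
  rcases lt_trichotomy (lift 0 x.1).1 ((lift 0 y.1).1 + k * (u : ℕ)) with h | h | h
  · exact key x hx y hy _ _ _ h hx1 hy1
  · refine hne (Subtype.ext ?_)
    rw [hy1, ← h]
    exact hx1
  · exact key y hy x hx _ _ _ h hy1 hx1

theorem blockSum_of_cut {Q : Finset C.cells} {d : ℤ}
    (h : Cut (Subtype.val '' (Q : Set C.cells)) d) :
    blockSum C.WeakEdge C.StrictEdge Q =
      open Classical in if Free C.WeakEdge Q then (-1) ^ Q.card else 0 :=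
  blockSum_of_labelled (fun x : C.cells => label d x.1) Q
    (fun x hx y hy => h.label_lt_of_right ⟨x, hx, rfl⟩ ⟨y, hy, rfl⟩)
    (fun x hx y hy => h.label_lt_of_below ⟨x, hx, rfl⟩ ⟨y, hy, rfl⟩)

theorem surjOn_content_of_not_cut {Q : Finset C.cells}
    (h : ∀ d, ¬ Cut (Subtype.val '' (Q : Set C.cells)) d) :
    Set.SurjOn (fun x : C.cells => content x.1) Q
      ((Finset.univ : Finset (ZMod ((u : ℕ) + v))) : Set _) := by
  intro c _
  obtain ⟨_, ⟨x, hx, rfl⟩, h2⟩ := exists_content_eq_of_not_cut h c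
  exact ⟨x, hx, h2⟩

theorem le_card_of_not_cut {Q : Finset C.cells}
    (h : ∀ d, ¬ Cut (Subtype.val '' (Q : Set C.cells)) d) : (u : ℕ) + v ≤ Q.card := by
  have := Finset.card_le_card_of_surjOn _ (surjOn_content_of_not_cut h)
  rwa [Finset.card_univ, ZMod.card] at this

theorem injOn_content_of_not_cut {Q : Finset C.cells}
    (h : ∀ d, ¬ Cut (Subtype.val '' (Q : Set C.cells)) d) (hcard : Q.card = (u : ℕ) + v) :
    Set.InjOn (fun x : C.cells => content x.1) Q := by
  classical
  have h1 : Q.image (fun x : C.cells => content x.1) = Finset.univ := by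
    rw [Finset.eq_univ_iff_forall]
    intro c
    obtain ⟨x, hx, h2⟩ := surjOn_content_of_not_cut h (Finset.mem_coe.2 (Finset.mem_univ c))
    exact Finset.mem_image.2 ⟨x, hx, h2⟩
  rw [← Finset.card_image_iff, h1, Finset.card_univ, ZMod.card, hcard]

/-! ### The rim as a closed ribbon -/

open Classical in
/-- The lower right boundary of `C`. -/
noncomputable def rim (C : CylindricSkewShape v u) : Finset C.cells :=
  Finset.univ.filter fun x => diag x.1 ∉ C.cells

theorem mem_rim {x : C.cells} : x ∈ C.rim ↔ diag x.1 ∉ C.cells := by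
  simp [rim]

theorem rim_upper {x y : C.cells} (hx : x ∈ C.rim) (h : x ≤ y) : y ∈ C.rim := by
  rw [mem_rim] at hx ⊢
  exact fun hy => hx (C.mem_of_le x.2 hy (le_diag _) (diag_mono h))

theorem not_mk_le_of_mem_rim {x y : C.cells} (hx : x ∈ C.rim) {i j i' j' : ℤ} (h : x.1 = Cylinder.mk i j)
    (h' : y.1 = Cylinder.mk i' j') (hi : i < i') (hj : j < j') : False := by
  rw [mem_rim, h, diag_mk] at hx
  refine hx (C.mem_of_le x.2 y.2 ?_ ?_)
  · rw [h]
    exact mk_le_mk (by linarith) (by linarith)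
  · rw [h']
    exact mk_le_mk hi hj

/-- Boxes of equal content lie on one diagonal, and by convexity the earlier of two has its diagonal
successor in C. -/
theorem injOn_content_rim : Set.InjOn (fun x : C.cells => content x.1) C.rim := by
  intro x hx y hy he
  obtain ⟨d, hd⟩ := ZMod.intCast_surjective (content x.1)
  obtain ⟨i, hi⟩ := exists_mk_of_content_eq hd.symm
  obtain ⟨i', hi'⟩ := exists_mk_of_content_eq (he.symm.trans hd.symm)
  rcases lt_trichotomy i i' with h | h | h
  · exact (not_mk_le_of_mem_rim hx hi hi' h (by linarith)).elim
  · exact Subtype.ext (by rw [hi, hi', h])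
  · exact (not_mk_le_of_mem_rim hy hi' hi h (by linarith)).elim

theorem exists_mem_rim_content_eq (x : C.cells) : ∃ y ∈ C.rim, content y.1 = content x.1 := by
  classical
  obtain ⟨y, hy, hmax⟩ := Finset.exists_max_image
    (Finset.univ.filter fun y : C.cells => content y.1 = content x.1) (fun y => height y.1)
    ⟨x, by simp⟩
  have hc := (Finset.mem_filter.1 hy).2
  refine ⟨y, mem_rim.2 fun h => ?_, hc⟩
  have := hmax ⟨_, h⟩ (Finset.mem_filter.2 ⟨Finset.mem_univ _, (content_diag _).trans hc⟩)
  exact absurd (height_lt_height_diag y.1) (not_lt.2 this)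

/-- On neighbouring diagonals, boxes that are not neighbours would have one strictly beyond the
other in both coordinates, which the rim excludes. -/
theorem adjacent_of_mem_rim {x y : C.cells} (hx : x ∈ C.rim) (hy : y ∈ C.rim)
    (h : content y.1 = content x.1 + 1) : C.StrictEdge x y ∨ C.WeakEdge y x := by
  obtain ⟨d, hd⟩ := ZMod.intCast_surjective (content x.1)
  obtain ⟨i, hi⟩ := exists_mk_of_content_eq hd.symm
  obtain ⟨i', hi'⟩ := exists_mk_of_content_eq (d := d + 1) (y := y.1) (by
    rw [h, ← hd]
    push_cast
    rfl)
  have h1 : i' ≤ i := by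
    by_contra hc
    exact not_mk_le_of_mem_rim hx hi hi' (not_le.1 hc) (by linarith)
  have h2 : i - 1 ≤ i' := by
    by_contra hc
    exact not_mk_le_of_mem_rim hy hi' hi (by linarith) (by omega)
  rcases h1.eq_or_lt with h3 | h3
  · left
    refine ⟨i, i + d, hi, ?_⟩
    rw [hi', h3, add_assoc]
  · right
    have h4 : i = i' + 1 := by omega
    refine ⟨i', i' + (d + 1), hi', ?_⟩
    rw [hi, h4]
    congr 1
    ring

theorem exists_mem_rim_content (hC : ∀ d, ¬ Cut (C.cells : Set (Cylinder v u)) d)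
    (c : ZMod ((u : ℕ) + v)) : ∃ x ∈ C.rim, content x.1 = c := by
  obtain ⟨x, hx, rfl⟩ := exists_content_eq_of_not_cut hC c
  exact exists_mem_rim_content_eq ⟨x, hx⟩

theorem card_rim (hC : ∀ d, ¬ Cut (C.cells : Set (Cylinder v u)) d) :
    C.rim.card = (u : ℕ) + v := by
  classical
  rw [← Finset.card_image_iff.2 (injOn_content_rim (C := C))]
  refine Eq.trans ?_ (ZMod.card ((u : ℕ) + v))
  rw [← Finset.card_univ]
  congr 1
  rw [Finset.eq_univ_iff_forall]
  intro c
  obtain ⟨x, hx, h⟩ := exists_mem_rim_content hC c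
  exact Finset.mem_image.2 ⟨x, hx, h⟩

/-- The only upper subset of size `u + v` that wraps around the cylinder is the rim. -/
theorem eq_rim_of_not_cut (hC : ∀ d, ¬ Cut (C.cells : Set (Cylinder v u)) d) {Q : Finset C.cells}
    (hQ : ∀ x ∈ Q, ∀ y, x ≤ y → y ∈ Q) (hcut : ∀ d, ¬ Cut (Subtype.val '' (Q : Set C.cells)) d)
    (hcard : Q.card = (u : ℕ) + v) : Q = C.rim := by
  refine Finset.eq_of_subset_of_card_le (fun x hx => mem_rim.2 fun h => ?_)
    (by rw [card_rim hC, hcard])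
  have h1 : (⟨diag x.1, h⟩ : C.cells) ∈ Q := hQ x hx _ (le_diag x.1)
  have h2 := injOn_content_of_not_cut hcut hcard hx h1 (content_diag x.1).symm
  have h3 := height_lt_height_diag x.1
  exact h3.ne (congrArg (fun y : C.cells => height y.1) h2)

/-- Removing any nonempty B opens the closed ribbon, so the remainder has a cut and contributes only
when free of weak edges. Exactly one allowed B achieves this, so a single sign survives. -/
theorem blockSum_rim_ne_zero (hC : ∀ d, ¬ Cut (C.cells : Set (Cylinder v u)) d) :
    blockSum C.WeakEdge C.StrictEdge C.rim ≠ 0 := by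
  classical
  have hnf : ¬ Free C.WeakEdge C.rim := by
    refine not_free_of_card_lt (fun x hx y hxy _ _ _ => rim_upper hx hxy) ?_
    have := u.pos
    rw [card_rim hC]
    omega
  have hne : C.rim.Nonempty := by
    rw [Finset.nonempty_iff_ne_empty]
    intro h
    rw [h] at hnf
    exact hnf fun x hx => absurd hx (Finset.notMem_empty _)
  -- The left ends of the weak edges: each must be removed, since B would otherwise miss its edge or
  -- fail to be closed under W.
  let B₀ := C.rim.filter fun x => ∃ y ∈ C.rim, C.WeakEdge x y
  have hB₀ : B₀.Nonempty := by
    simp only [Free, not_forall, not_not] at hnf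
    obtain ⟨x, hx, y, hy, h⟩ := hnf
    exact ⟨x, Finset.mem_filter.2 ⟨hx, y, hy, h⟩⟩
  have hu : (0 : ℤ) < (u : ℕ) := by exact_mod_cast u.pos
  have hv : (0 : ℤ) < (v : ℕ) := by exact_mod_cast v.pos
  have hA₀ : Allowed C.WeakEdge C.StrictEdge C.rim B₀ := by
    intro x hx y hy
    obtain ⟨hy, z, hz, hyz⟩ := Finset.mem_filter.1 hy
    refine ⟨fun h => Finset.mem_filter.2 ⟨hx, y, hy, h⟩, fun h => ?_⟩
    have h1 : Below x.1 y.1 := h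
    have h2 : Right y.1 z.1 := hyz
    -- If x is above y and y is left of z, then x and z have equal content, so they coincide; but
    -- the height has increased.
    have h3 : z = x := injOn_content_rim hz hx (by
      change content z.1 = content x.1
      rw [h2.content_eq, h1.content_eq]
      ring)
    have h4 := h1.height_eq
    have h5 := h2.height_eq
    rw [h3] at h5
    linarith
  have hF₀ : Free C.WeakEdge (C.rim \ B₀) := by
    intro x hx y hy h
    rw [Finset.mem_sdiff] at hx hy
    exact hx.2 (Finset.mem_filter.2 ⟨hx.1, y, hy.1, h⟩)
  have huniq : ∀ B, Allowed C.WeakEdge C.StrictEdge C.rim B → B ⊆ C.rim →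
      Free C.WeakEdge (C.rim \ B) → B = B₀ := by
    intro B hA hB hF
    refine Finset.Subset.antisymm (fun y hy => ?_) (fun x hx => ?_)
    · obtain ⟨x, hx, hc⟩ := exists_mem_rim_content hC (content y.1 - 1)
      rcases adjacent_of_mem_rim hx (hB hy) (by rw [hc]; ring) with h | h
      · exact absurd h (hA x hx y hy).2
      · exact Finset.mem_filter.2 ⟨hB hy, x, hx, h⟩
    · obtain ⟨hx, y, hy, h⟩ := Finset.mem_filter.1 hx
      by_contra hxB
      by_cases hyB : y ∈ B
      · exact hxB ((hA x hx y hyB).1 h)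
      · exact hF x (Finset.mem_sdiff.2 ⟨hx, hxB⟩) y (Finset.mem_sdiff.2 ⟨hy, hyB⟩) h
  have hsum : ∀ B ∈ C.rim.powerset.filter
      (fun B => B.Nonempty ∧ Allowed C.WeakEdge C.StrictEdge C.rim B),
      blockSum C.WeakEdge C.StrictEdge (C.rim \ B) =
        if B = B₀ then (-1) ^ (C.rim \ B).card else 0 := by
    intro B hB
    obtain ⟨hB, ⟨b, hb⟩, hA⟩ := Finset.mem_filter.1 hB
    have hsub := Finset.mem_powerset.1 hB
    -- Since b is the only rim box of its content, that residue disappears from the complement.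
    obtain ⟨d, hd⟩ := ZMod.intCast_surjective (content b.1)
    have hcut : Cut (Subtype.val '' ((C.rim \ B : Finset C.cells) : Set C.cells)) d := by
      refine cut_of_content_ne d ?_
      rintro _ ⟨x, hx, rfl⟩ hc
      obtain ⟨hx1, hx2⟩ := Finset.mem_sdiff.1 (Finset.mem_coe.1 hx)
      have : x = b := injOn_content_rim hx1 (hsub hb) (hc.trans hd)
      exact hx2 (this ▸ hb)
    rw [blockSum_of_cut hcut]
    refine if_congr ⟨huniq B hA hsub, ?_⟩ rfl rfl
    rintro rfl
    exact hF₀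
  rw [blockSum_of_nonempty _ _ hne, Finset.sum_congr rfl hsum, Finset.sum_ite_eq', if_pos]
  · exact neg_ne_zero.2 (pow_ne_zero _ (by norm_num))
  · exact Finset.mem_filter.2 ⟨Finset.mem_powerset.2 (Finset.filter_subset _ _), hB₀, hA₀⟩

/-! ### The contradiction for shapes that wrap around -/

theorem level_upper {k : ℕ} {q : ℕ+} {d : ℕ+ →₀ ℕ} {T : C.cells → ℕ+}
    (hT : IsPrefix C.WeakEdge C.StrictEdge k q d T) :
    ∀ x ∈ level q T, ∀ y, x ≤ y → y ∈ level q T := by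
  intro x hx y hxy
  rw [mem_level] at hx ⊢
  refine le_antisymm (hT.le y) ?_
  rw [← hx]
  refine rel_of_le (r := fun x y => T x ≤ T y) (fun _ => le_rfl) (fun _ _ _ => le_trans) hT.weak
    (fun x y h => ?_) hxy
  rcases hT.strict x y h with h | h
  · exact h.le
  · rw [h.1, h.2]

/-- The height increases strictly along all edges. Since the rim is an upper set, its entries can be
replaced by one value q above all others. -/
theorem exists_prefix_rim (C : CylindricSkewShape v u) : ∃ (q : ℕ+) (d : ℕ+ →₀ ℕ)
    (T : C.cells → ℕ+), (∀ r, q ≤ r → d r = 0) ∧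
      IsPrefix C.WeakEdge C.StrictEdge C.rim.card q d T ∧ level q T = C.rim := by
  classical
  obtain ⟨m, hm⟩ := (Set.finite_range fun x : C.cells => height x.1).bddBelow
  have hm : ∀ x : C.cells, m ≤ height x.1 := fun x => hm ⟨x, rfl⟩
  let g : C.cells → ℕ+ := fun x => (height x.1 - m).toNat.succPNat
  have hg : ∀ x y : C.cells, height x.1 < height y.1 → g x < g y := by
    intro x y h
    have := hm x
    have := hm y
    rw [← PNat.coe_lt_coe]
    simp only [g, Nat.succPNat_coe]
    omega
  obtain ⟨q₀, hq₀⟩ := (Set.finite_range g).bddAbove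
  have hq : ∀ x, g x < q₀ + 1 := fun x => PNat.lt_add_one_iff.2 (hq₀ ⟨x, rfl⟩)
  generalize q₀ + 1 = q at hq
  let T : C.cells → ℕ+ := fun x => if x ∈ C.rim then q else g x
  have hR : level q T = C.rim := by
    ext x
    rw [mem_level]
    dsimp only [T]
    split_ifs with h
    · simp [h]
    · simp [h, (hq x).ne]
  have hlt : ∀ x y : C.cells, x ≤ y → height x.1 < height y.1 → T x < T y ∨ T x = q ∧ T y = q := by
    intro x y hxy hh
    dsimp only [T]
    by_cases hx : x ∈ C.rim
    · right
      simp [hx, rim_upper hx hxy]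
    · left
      rw [if_neg hx]
      split_ifs
      · exact hq x
      · exact hg x y hh
  have hu : (0 : ℤ) < (u : ℕ) := by exact_mod_cast u.pos
  have hv : (0 : ℤ) < (v : ℕ) := by exact_mod_cast v.pos
  let d : ℕ+ →₀ ℕ := ∑ x with x ∉ C.rim, Finsupp.single (g x) 1
  have hd : ∀ r, d r = (Finset.univ.filter fun x => x ∉ C.rim ∧ g x = r).card := by
    intro r
    simp only [d, Finsupp.finsetSum_apply, Finsupp.single_apply]
    rw [← Finset.filter_filter, Finset.card_filter]
  refine ⟨q, d, T, fun r hr => ?_, ⟨fun x => ?_, by rw [hR], fun r hr => ?_, fun x y h => ?_,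
    fun x y h => ?_⟩, hR⟩
  · rw [hd, Finset.card_eq_zero, Finset.filter_eq_empty_iff]
    exact fun x _ h => absurd (hq x) (not_lt.2 (h.2 ▸ hr))
  · dsimp only [T]
    split_ifs
    · exact le_rfl
    · exact (hq x).le
  · rw [hd]
    congr 1
    ext x
    rw [mem_level, Finset.mem_filter]
    dsimp only [T]
    split_ifs with h
    · simp [h, hr.ne']
    · simp [h]
  · have h' : Right x.1 y.1 := h
    rcases hlt x y h'.le (by rw [h'.height_eq]; linarith) with h1 | h1
    · exact h1.le
    · rw [h1.1, h1.2]
  · have h' : Below x.1 y.1 := h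
    exact hlt x y h'.le (by rw [h'.height_eq]; linarith)

theorem not_isFPositive_of_not_cut (hu : u ≠ 1)
    (hC : ∀ d, ¬ Cut (C.cells : Set (Cylinder v u)) d) : ¬ IsFPositive C.schur := by
  classical
  intro hF
  rw [schur_eq_genFun (W := C.WeakEdge) (S := C.StrictEdge)
    fun _ => isSemistandard_iff_compatible] at hF
  have hu2 : 2 ≤ (u : ℕ) := by
    have h1 : (u : ℕ) ≠ 1 := fun h => hu (PNat.eq h)
    have := u.pos
    omega
  obtain ⟨q, d, T₀, hd, hT₀, hlevel⟩ := exists_prefix_rim C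
  have hcut0 : ∀ {k : ℕ} {q : ℕ+} {d : ℕ+ →₀ ℕ} {T : C.cells → ℕ+},
      IsPrefix C.WeakEdge C.StrictEdge k q d T → (v : ℕ) < k →
      (∃ c, Cut (Subtype.val '' (level q T : Set C.cells)) c) →
      blockSum C.WeakEdge C.StrictEdge (level q T) = 0 := by
    rintro k q d T hT hk ⟨c, hc⟩
    rw [blockSum_of_cut hc, if_neg]
    exact not_free_of_card_lt (fun x hx y hxy _ _ _ => level_upper hT x hx y hxy)
      (by rwa [hT.card_level])
  -- Here k = u + v - 1 exceeds v because u ≥ 2, yet is too small for a level without a cut.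
  obtain ⟨k, hk⟩ : ∃ k, (u : ℕ) + v = k + 1 := ⟨(u : ℕ) + v - 1, by omega⟩
  have h1 : blockFunctional k (q + 1) (d + Finsupp.single q 1)
      (genFun C.WeakEdge C.StrictEdge) = 0 := by
    rw [blockFunctional_genFun _ _ _ _ _ (add_single_apply_eq_zero hd 1)]
    refine Finset.sum_eq_zero fun T hT => ?_
    have hT := mem_prefixes.1 hT
    refine hcut0 hT (by omega) ?_
    by_contra hc
    have := le_card_of_not_cut (not_exists.1 hc)
    rw [hT.card_level] at this
    omega
  have h2 := hF.blockFunctional_succ_eq_zero hd h1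
  rw [blockFunctional_genFun _ _ _ _ _ hd] at h2
  have h3 : ∀ T ∈ prefixes C.WeakEdge C.StrictEdge (k + 1) q d,
      blockSum C.WeakEdge C.StrictEdge (level q T) =
        if level q T = C.rim then blockSum C.WeakEdge C.StrictEdge C.rim else 0 := by
    intro T hT
    have hT := mem_prefixes.1 hT
    split_ifs with h
    · rw [h]
    · refine hcut0 hT (by omega) ?_
      by_contra hc
      exact h (eq_rim_of_not_cut hC (level_upper hT) (not_exists.1 hc) (by
        rw [hT.card_level, hk]))
  -- The value is the number of prefixes whose top level is the rim, times the `blockSum` of the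
  -- rim; both factors are nonzero.
  rw [Finset.sum_congr rfl h3, ← Finset.sum_filter, Finset.sum_const, smul_eq_zero] at h2
  rcases h2 with h2 | h2
  · rw [Finset.card_eq_zero, Finset.filter_eq_empty_iff] at h2
    refine h2 (mem_prefixes.2 ?_) hlevel
    rwa [← hk, ← card_rim hC]
  · exact blockSum_rim_ne_zero hC h2

end CylindricSkewShape

end CylindricSchur

theorem mainTheorem3 (v u : ℕ+) (C : CylindricSchur.CylindricSkewShape v u) :
    CylindricSchur.IsFPositive C.schur ↔ C.IsoSkewShape := by
  refine ⟨fun h => ?_, CylindricSchur.CylindricSkewShape.IsoSkewShape.isFPositive⟩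
  by_cases hu : u = 1
  · subst hu
    exact CylindricSchur.CylindricSkewShape.isoSkewShape_of_one
  · by_contra hiso
    exact CylindricSchur.CylindricSkewShape.not_isFPositive_of_not_cut hu
      (fun d hd => hiso (CylindricSchur.CylindricSkewShape.isoSkewShape_of_cut hd)) h
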